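/- Let $\Sigma=\{l,r\}$, with $l$ before $r$. A word $w\in\Sigma^+$ is regarded as the structure whose domain is its set of positions, with the order $<$ and the unary predicates $P_l,P_r$. The size of a formula of monadic second-order logic MSO over $\{<,P_l,P_r\}$ is its number of atomic subformulas, connectives $\neg,\wedge,\vee$ and first-order and set quantifiers, counted with multiplicity; $\mathrm{MSO}[n]$ is the set of sentences of size at most $n$. A sentence $\phi$ defines $w\in\Sigma^+$ if $w$ is the only word in $\Sigma^+$ that satisfies $\phi$. For $\phi$ let $\mu(\phi)$ and $\nu(\phi)$ be the minimal and the maximal length of a model of $\phi$ in $\Sigma^+$, where $\mu(\phi)=0$ if $\phi$ has no model, and $\nu(\phi)=0$ if $\phi$ has no model or arbitrarily long models. Put $\mathrm{DN}(L)=\max\{|w| : w \text{ is defined by some } \phi\in L\}$, $\mathrm{LS}(L)=\max_{\phi\in L}\mu(\phi)$ and $\mathrm{H}(L)=\max_{\phi\in L}\nu(\phi)$. Let $\mathrm{tower}(0)=1$, $\mathrm{tower}(k+1)=2^{\mathrm{tower}(k)}$ and $\mathrm{twr}(x)=\mathrm{tower}(\lceil x\rceil)$ for real $x\ge 0$. Let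 $V_0=\emptyset$ and let $V_{i+1}$ be the power set of $V_i$. A word encodes a set $x$ if it is $l\,w_1\cdots w_k\,r$ with $k\ge 0$, where $w_j$ encodes $x_j$ and $x=\{x_1,\dots,x_k\}$ (any order, repetitions allowed). There are a constant $c\in\mathbb{N}$, $c\geq 1$, and MSO sentences $\psi_0,\psi_1,\psi_2,\dots$ of size $O(i^2)$ such that: (a) for every $i\in\mathbb{N}$, $\psi_i$ defines the shortlex-least word $w_i$ that encodes $V_i$ (shorter words come first, words of equal length are ordered lexicographically); (b) for infinitely many $n\in\mathbb{N}$, $$\mathrm{DN}(\mathrm{MSO}[n]),\ \mathrm{LS}(\mathrm{MSO}[n]),\ \mathrm{H}(\mathrm{MSO}[n])\ \ge\ \mathrm{twr}\bigl(\sqrt{n/c}\bigr),$$ and this is witnessed by some $\psi_i$: there is an $i$ with $\psi_i\in\mathrm{MSO}[n]$ and $|w_i|\ge\mathrm{twr}(\sqrt{n/c})$. -/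

import Mathlib

open Filter Asymptotics

/-- The two-letter alphabet `Σ = {l, r}` (left and right brace). -/
inductive Letter : Type
  | l : Letter
  | r : Letter
  deriving DecidableEq

namespace Letter

/-- The order of the alphabet: `l` precedes `r`. -/
def Precedes (a b : Letter) : Prop := a = l ∧ b = r

end Letter

/-- Words over `Σ`. The elements of `Σ⁺` are the words `w ≠ []`. -/
abbrev Word : Type := List Letter

namespace MSO

/-- Formulas of monadic second-order logic in the vocabulary `{<, P_l, P_r}`, with free set
variables indexed by `Fin m` and free first-order variables indexed by `Fin k`. A quantifier binds
the variable with index `0` of its body; the other variables of the body are shifted by one. -/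
inductive Formula : ℕ → ℕ → Type
  | eq {m k : ℕ} (x y : Fin k) : Formula m k
  | lt {m k : ℕ} (x y : Fin k) : Formula m k
  | letter {m k : ℕ} (a : Letter) (x : Fin k) : Formula m k
  | mem {m k : ℕ} (U : Fin m) (x : Fin k) : Formula m k
  | neg {m k : ℕ} (φ : Formula m k) : Formula m k
  | and {m k : ℕ} (φ ψ : Formula m k) : Formula m k
  | or {m k : ℕ} (φ ψ : Formula m k) : Formula m k
  | ex {m k : ℕ} (φ : Formula m (k + 1)) : Formula m k
  | all {m k : ℕ} (φ : Formula m (k + 1)) : Formula m k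
  | exSet {m k : ℕ} (φ : Formula (m + 1) k) : Formula m k
  | allSet {m k : ℕ} (φ : Formula (m + 1) k) : Formula m k

/-- Sentences: formulas without free variables. -/
abbrev Sentence : Type := Formula 0 0

namespace Formula

/-- The size of a formula. -/
def size {m k : ℕ} : Formula m k → ℕ
  | eq _ _ => 1
  | lt _ _ => 1
  | letter _ _ => 1
  | mem _ _ => 1
  | neg φ => φ.size + 1
  | and φ ψ => φ.size + ψ.size + 1
  | or φ ψ => φ.size + ψ.size + 1
  | ex φ => φ.size + 1
  | all φ => φ.size + 1
  | exSet φ => φ.size + 1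
  | allSet φ => φ.size + 1

/-- Satisfaction in the word model of `w`, whose domain is the set `Fin w.length` of positions with
its usual order, under an assignment of sets of positions to the set variables and of positions to
the first-order variables. -/
def Sat (w : Word) {m k : ℕ} :
    Formula m k → (Fin m → Set (Fin w.length)) → (Fin k → Fin w.length) → Prop
  | eq x y, _, p => p x = p y
  | lt x y, _, p => p x < p y
  | letter a x, _, p => w.get (p x) = a
  | mem U x, P, p => p x ∈ P U
  | neg φ, P, p => ¬ φ.Sat w P p
  | and φ ψ, P, p => φ.Sat w P p ∧ ψ.Sat w P p
  | or φ ψ, P, p => φ.Sat w P p ∨ ψ.Sat w P p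
  | ex φ, P, p => ∃ a : Fin w.length, φ.Sat w P (Fin.cons a p)
  | all φ, P, p => ∀ a : Fin w.length, φ.Sat w P (Fin.cons a p)
  | exSet φ, P, p => ∃ A : Set (Fin w.length), φ.Sat w (Fin.cons A P) p
  | allSet φ, P, p => ∀ A : Set (Fin w.length), φ.Sat w (Fin.cons A P) p

end Formula

/-- `w ⊨ φ` for a sentence `φ`. -/
def Models (w : Word) (φ : Sentence) : Prop := φ.Sat w Fin.elim0 Fin.elim0

/-- The sentences of the fragment `MSO[n]`: those of size at most `n`. -/
def sizeFragment (n : ℕ) : Set Sentence := {φ | φ.size ≤ n}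

/-- `φ` defines `w ∈ Σ⁺`: `w` is the only word in `Σ⁺` that satisfies `φ`. -/
def Defines (φ : Sentence) (w : Word) : Prop :=
  w ≠ [] ∧ Models w φ ∧ ∀ v : Word, v ≠ [] → v ≠ w → ¬ Models v φ

/-- The set `Def(L)` of words in `Σ⁺` that are definable in the fragment `L`. -/
def Def (L : Set Sentence) : Set Word := {w | ∃ φ ∈ L, Defines φ w}

/-- The lengths of the models in `Σ⁺` of a sentence. -/
def modelLengths (φ : Sentence) : Set ℕ := {k | ∃ w : Word, w ≠ [] ∧ Models w φ ∧ w.length = k}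

/-- The minimal length `μ(φ)` of a model of `φ`; it is `0` if `φ` has no model
(`sInf ∅ = 0` in `ℕ`). -/
noncomputable def minLength (φ : Sentence) : ℕ := sInf (modelLengths φ)

/-- The maximal length `ν(φ)` of a model of `φ`; it is `0` if `φ` has no model or has arbitrarily
long models (in `ℕ` the `sSup` of an empty or unbounded set is `0`). -/
noncomputable def maxLength (φ : Sentence) : ℕ := sSup (modelLengths φ)

/-- The definability number `DN(L)`: the maximal length of a word in `Def(L)`. -/
noncomputable def DN (L : Set Sentence) : ℕ := sSup {k | ∃ w ∈ Def L, w.length = k}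

/-- The Löwenheim-Skolem number `LS(L)`: the maximum of `μ(φ)` for `φ ∈ L`. -/
noncomputable def LS (L : Set Sentence) : ℕ := sSup {k | ∃ φ ∈ L, minLength φ = k}

/-- The Hanf number `H(L)`: the maximum of `ν(φ)` for `φ ∈ L`. -/
noncomputable def H (L : Set Sentence) : ℕ := sSup {k | ∃ φ ∈ L, maxLength φ = k}

end MSO

/-- The exponential tower: `tower 0 = 1` and `tower (n + 1) = 2 ^ tower n`. -/
def tower : ℕ → ℕ
  | 0 => 1
  | n + 1 => 2 ^ tower n

/-- `twr x = tower ⌈x⌉` for real `x ≥ 0`. -/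
noncomputable def twr (x : ℝ) : ℕ := tower ⌈x⌉₊

/-- `Encodes w x`: the word `w` represents the set `x` by braces, that is `w = l w₁ ⋯ wₖ r` where
`wⱼ` represents `xⱼ` and `x = {x₁, …, xₖ}`. The elements may be listed in any order and with
repetitions. -/
inductive Encodes : Word → ZFSet.{0} → Prop
  | empty : Encodes [Letter.l, Letter.r] ∅
  | insert {u v : Word} {x y : ZFSet.{0}} :
      Encodes u x → Encodes (Letter.l :: (v ++ [Letter.r])) y →
        Encodes (Letter.l :: (u ++ v ++ [Letter.r])) (insert x y)

/-- `w` is the shortlex-least encoding of the set `x`: it encodes `x`, and it precedes every other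
encoding of `x` in the order that puts shorter words first and compares words of the same length
lexicographically, with `l` before `r`. -/
def IsLeastEncoding (w : Word) (x : ZFSet.{0}) : Prop :=
  Encodes w x ∧ ∀ v : Word, Encodes v x → v ≠ w → List.Shortlex Letter.Precedes w v

/-! A brace word parses uniquely as an ordered tree, so the encodings of a set are the trees with
that value. In a shortlex-minimal tree every subtree is minimal and siblings increase
lexicographically: otherwise one could replace a child, delete a duplicate or swap two children.
Because the closing brace is the later letter, a minimal tree that is lexicographically smaller has
a value that is smaller for `MinDiffLt`, an order on the sets themselves (`IsMinimal.minDiffLt`).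
Hence a minimal tree is hereditarily sorted, and such a tree is determined by its value
(`HereditarilySorted.eq`). So the least encoding of `V_i` is defined by saying: hereditarily sorted,
with value `V_i`.

MSO says this in size O(i^2). A reflexive transitive closure costs one set quantifier and one copy
of the relation, so the blocks that encode elements of level `j` cost O(j). Equality of represented
sets recurses on the level with a single recursive call, at cost O(i) per level. One set quantifier
over the children of the root forces the value `V_i` (`full_iff`). The order needs no recursion:
`V_i` is transitive, so the list of children of the root displays the order of all sets involved,
and it suffices to check this list against the recursive clause of the order and all other lists
against it (`isSortedLevel_iff`).

Finally `V_(i+1)` has `tower i` elements, each with its own child of the root, so a sentence of size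
O(i^2) defines a word of length at least `tower (i - 1)`. -/

/-! ### Trees, their brace words and the sets they represent -/

/-- Ordered trees with finitely many nodes, in the first-child next-sibling representation: `nil` is
a node without children, and `cons t s` is `s` with the additional first child `t`. -/
inductive BraceTree : Type
  | nil : BraceTree
  | cons (t s : BraceTree) : BraceTree

namespace BraceTree

/-- The list of the children of the root. -/
def children : BraceTree → List BraceTree
  | nil => []
  | cons t s => t :: s.children

/-- The tree with a given list of children of the root. -/
def node : List BraceTree → BraceTree
  | [] => nil
  | t :: ts => cons t (node ts)

/-- The representation by braces without the outermost pair. -/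
def body : BraceTree → Word
  | nil => []
  | cons t s => (Letter.l :: (t.body ++ [Letter.r])) ++ s.body

/-- The representation by braces. -/
def enc (t : BraceTree) : Word := Letter.l :: (t.body ++ [Letter.r])

/-- The set represented by a tree. -/
def val : BraceTree → ZFSet.{0}
  | nil => ∅
  | cons t s => insert t.val s.val

@[simp] theorem children_node (ts : List BraceTree) : (node ts).children = ts := by
  induction ts <;> simp_all [node, children]

@[simp] theorem node_children (t : BraceTree) : node t.children = t := by
  induction t <;> simp_all [node, children]

theorem body_eq (t : BraceTree) : t.body = t.children.flatMap enc := by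
  induction t with
  | nil => rfl
  | cons t s _ ih => simp [body, children, ih, enc]

theorem enc_eq (t : BraceTree) : t.enc = Letter.l :: (t.children.flatMap enc ++ [Letter.r]) := by
  rw [enc, body_eq]

theorem enc_node (ts : List BraceTree) : (node ts).enc = Letter.l :: (ts.flatMap enc ++ [Letter.r]) := by
  rw [enc_eq, children_node]

theorem mem_val {t : BraceTree} {x : ZFSet} : x ∈ t.val ↔ ∃ s ∈ t.children, s.val = x := by
  induction t with
  | nil => simp [val, children]
  | cons t s _ ih => simp [val, children, ih, eq_comm]

theorem val_mem_val {s t : BraceTree} (h : s ∈ t.children) : s.val ∈ t.val := mem_val.2 ⟨s, h, rfl⟩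

theorem val_eq_iff {s t : BraceTree} : s.val = t.val ↔
    (∀ a ∈ s.children, ∃ b ∈ t.children, a.val = b.val) ∧
      ∀ b ∈ t.children, ∃ a ∈ s.children, b.val = a.val := by
  constructor
  · intro h
    refine ⟨fun a ha => ?_, fun b hb => ?_⟩
    · obtain ⟨b, hb, e⟩ := mem_val.1 (h ▸ val_mem_val ha)
      exact ⟨b, hb, e.symm⟩
    · obtain ⟨a, ha, e⟩ := mem_val.1 (h ▸ val_mem_val hb)
      exact ⟨a, ha, e.symm⟩
  · rintro ⟨h₁, h₂⟩
    ext x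
    simp only [mem_val]
    constructor
    · rintro ⟨a, ha, rfl⟩
      obtain ⟨b, hb, e⟩ := h₁ a ha
      exact ⟨b, hb, e.symm⟩
    · rintro ⟨b, hb, rfl⟩
      obtain ⟨a, ha, e⟩ := h₂ b hb
      exact ⟨a, ha, e.symm⟩

/-- The structural recursor sees a first child and the remaining siblings; strengthening the claim
to all children turns it into induction along the child relation. -/
theorem children_induction {P : BraceTree → Prop} (h : ∀ t, (∀ s ∈ t.children, P s) → P t) (t : BraceTree) :
    P t := by
  have key : ∀ t : BraceTree, (∀ s ∈ t.children, P s) := by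
    intro t
    induction t with
    | nil => simp [children]
    | cons t s iht ihs =>
      intro u hu
      rcases List.mem_cons.1 hu with rfl | hu
      · exact h _ iht
      · exact ihs u hu
  exact h t (key t)

theorem encodes_enc (t : BraceTree) : Encodes t.enc t.val := by
  induction t with
  | nil => exact Encodes.empty
  | cons t s iht ihs =>
    have := Encodes.insert iht ihs
    simpa [enc, body, val] using this

theorem _root_.Encodes.exists_tree {w : Word} {x : ZFSet} (h : Encodes w x) :
    ∃ t : BraceTree, t.enc = w ∧ t.val = x := by
  induction h with
  | empty => exact ⟨nil, rfl, rfl⟩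
  | @insert u v x y _ _ ih₁ ih₂ =>
    obtain ⟨t, rfl, rfl⟩ := ih₁
    obtain ⟨s, hs, rfl⟩ := ih₂
    have : s.body = v := by simpa [enc] using hs
    exact ⟨cons t s, by simp [enc, body, this], rfl⟩

/-- Unique parsing: the next letter tells whether another child opens or the node closes. The
arbitrary remainders `x`, `x'` let the induction pass from a child to its siblings. -/
theorem body_append_inj {t t' : BraceTree} {x x' : Word}
    (h : t.body ++ Letter.r :: x = t'.body ++ Letter.r :: x') : t = t' ∧ x = x' := by
  induction t generalizing t' x x' with
  | nil =>
    cases t' with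
    | nil => simpa [body] using h
    | cons a b => simp [body] at h
  | cons a b iha ihb =>
    cases t' with
    | nil => simp [body] at h
    | cons a' b' =>
      simp only [body, List.cons_append, List.append_assoc, List.nil_append, List.cons.injEq,
        true_and] at h
      obtain ⟨rfl, h₁⟩ := iha h
      obtain ⟨rfl, h₂⟩ := ihb h₁
      exact ⟨rfl, h₂⟩

theorem enc_append_inj {t t' : BraceTree} {x x' : Word} (h : t.enc ++ x = t'.enc ++ x') :
    t = t' ∧ x = x' := by
  apply body_append_inj
  simpa [enc] using h

theorem enc_injective : Function.Injective enc := fun t t' h =>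
  (enc_append_inj (x := []) (x' := []) (by simpa using h)).1

theorem eq_of_enc_prefix {t t' : BraceTree} (h : t.enc <+: t'.enc) : t = t' := by
  obtain ⟨x, hx⟩ := h
  exact (enc_append_inj (x' := []) (by simpa using hx)).1

/-- Where `us` ends, the letter `l` shows that the list `ts` is not yet exhausted. This is how a
formula tells the start of a further child from the closing brace of the parent. -/
theorem prefix_of_flatMap_enc {us ts : List BraceTree} {x y : Word}
    (h : us.flatMap enc ++ Letter.l :: x = ts.flatMap enc ++ Letter.r :: y) :
    ∃ t vs, ts = us ++ t :: vs := by
  induction us generalizing ts with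
  | nil =>
    cases ts with
    | nil => simp at h
    | cons t vs => exact ⟨t, vs, rfl⟩
  | cons u us ih =>
    cases ts with
    | nil => simp [enc] at h
    | cons t ts =>
      simp only [List.flatMap_cons, List.append_assoc] at h
      obtain ⟨rfl, h'⟩ := enc_append_inj h
      obtain ⟨t, vs, rfl⟩ := ih h'
      exact ⟨t, vs, rfl⟩

theorem length_enc_pos (t : BraceTree) : 0 < t.enc.length := by simp [enc]

theorem length_children_le (t : BraceTree) : t.children.length ≤ t.enc.length := by
  induction t with
  | nil => simp [children]
  | cons t s _ ih =>
    simp only [children, enc, body, List.length_cons, List.length_append, List.length_nil] at ih ⊢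
    omega

end BraceTree

/-! ### Lexicographic comparison of words -/

namespace Letter

instance : Std.Trichotomous Precedes :=
  ⟨fun a b h₁ h₂ => by cases a <;> cases b <;> simp_all [Precedes]⟩

instance : Std.Asymm Precedes :=
  ⟨fun a b h₁ h₂ => by cases a <;> cases b <;> simp_all [Precedes]⟩

theorem wellFounded_precedes : WellFounded Precedes := by
  have hl : Acc Precedes l := ⟨_, fun b hb => by simp [Precedes] at hb⟩
  refine ⟨fun a => ⟨_, fun b hb => ?_⟩⟩
  rw [hb.1]
  exact hl

end Letter

section Lex

variable {α : Type*} {r : α → α → Prop}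

theorem List.Lex.append_of_not_prefix {a b : List α} (h : List.Lex r a b) (hp : ¬ a <+: b)
    (x y : List α) : List.Lex r (a ++ x) (b ++ y) := by
  induction h with
  | nil => simp at hp
  | cons _ ih => exact .cons (ih (by simpa using hp))
  | rel h => exact .rel h

theorem List.Lex.of_append {a b x y : List α} (h : List.Lex r (a ++ x) (b ++ y)) (h₁ : ¬ a <+: b)
    (h₂ : ¬ b <+: a) : List.Lex r a b := by
  induction a generalizing b with
  | nil => simp at h₁
  | cons c a ih =>
    cases b with
    | nil => simp at h₂
    | cons d b =>
      simp only [List.cons_append] at h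
      cases h with
      | cons h => exact .cons (ih h (by simpa using h₁) (by simpa using h₂))
      | rel h => exact .rel h

theorem List.Lex.of_append_left [Std.Irrefl r] {a x y : List α}
    (h : List.Lex r (a ++ x) (a ++ y)) : List.Lex r x y := by
  induction a with
  | nil => exact h
  | cons c a ih => exact ih (List.lex_cons_iff.1 h)

end Lex

theorem lex_precedes_trans {a b c : Word} (h₁ : List.Lex Letter.Precedes a b)
    (h₂ : List.Lex Letter.Precedes b c) : List.Lex Letter.Precedes a c := by
  induction h₁ generalizing c with
  | nil => cases h₂ <;> exact .nil
  | cons _ ih =>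
    cases h₂ with
    | cons h => exact .cons (ih h)
    | rel h => exact .rel h
  | rel h =>
    cases h₂ with
    | cons h' => exact .rel h
    | rel h' =>
      obtain ⟨rfl, rfl⟩ := h
      simp [Letter.Precedes] at h'

/-! ### The intrinsic order of sets and sorted trees -/

/-- The strict order on hereditarily finite sets in which `x` precedes `y` if the least element of
their symmetric difference belongs to `x`. -/
inductive MinDiffLt : ZFSet.{0} → ZFSet.{0} → Prop
  | mk {x y z : ZFSet.{0}} : z ∈ x → z ∉ y → (∀ u ∈ y, u ∉ x → MinDiffLt z u) → MinDiffLt x y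

/-- Witnesses `z` and `w` for the two directions would both lie in the symmetric difference, on
opposite sides, so each would precede the other; induction excludes this. -/
theorem MinDiffLt.asymm {x y : ZFSet} (h : MinDiffLt x y) : ¬ MinDiffLt y x := by
  induction h with
  | @mk x y z hz hz' _ ih =>
    rintro (⟨hw, hw', h⟩)
    exact ih _ hw hw' (h _ hz hz')

theorem MinDiffLt.irrefl (x : ZFSet) : ¬ MinDiffLt x x := fun h => h.asymm h

namespace BraceTree

/-- The descendants of the root of a tree, including the root itself. -/
def Descendant (t s : BraceTree) : Prop := Relation.ReflTransGen (fun a b => b ∈ a.children) t s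

/-- All lists of children in the tree are strictly increasing. -/
def HereditarilySorted (t : BraceTree) : Prop :=
  ∀ s, t.Descendant s → s.children.Pairwise fun a b => MinDiffLt a.val b.val

theorem HereditarilySorted.child {s t : BraceTree} (h : t.HereditarilySorted) (hs : s ∈ t.children) :
    s.HereditarilySorted := fun u hu => h u (.head hs hu)

/-- By induction the two lists of children have the same members. They have no repetitions, and an
asymmetric relation admits at most one sorted arrangement; neither transitivity nor totality is
needed. -/
theorem HereditarilySorted.eq {s t : BraceTree} (hs : s.HereditarilySorted) (ht : t.HereditarilySorted)
    (h : s.val = t.val) : s = t := by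
  induction s using children_induction generalizing t with
  | h s ih =>
  have hps := hs s .refl
  have hpt := ht t .refl
  obtain ⟨h₁, h₂⟩ := val_eq_iff.1 h
  have nd : ∀ l : List BraceTree, l.Pairwise (fun a b => MinDiffLt a.val b.val) → l.Nodup :=
    fun l hl => List.nodup_iff_pairwise_ne.2 <| hl.imp fun {a b} hab e => by
      subst e
      exact MinDiffLt.irrefl _ hab
  have perm : s.children.Perm t.children := by
    rw [List.perm_ext_iff_of_nodup (nd _ hps) (nd _ hpt)]
    intro a
    constructor
    · intro ha
      obtain ⟨b, hb, e⟩ := h₁ a ha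
      rwa [ih a ha (hs.child ha) (ht.child hb) e]
    · intro hb
      obtain ⟨b, ha, e⟩ := h₂ a hb
      rwa [← ih b ha (hs.child ha) (ht.child hb) e.symm]
  have : s.children = t.children :=
    perm.eq_of_pairwise (fun a b _ _ h₁ h₂ => (h₁.asymm h₂).elim) hps hpt
  rw [← node_children s, this, node_children]

/-! ### Minimal encodings are hereditarily sorted -/

/-- The word of a tree is a shortlex-minimal encoding of the set. -/
def IsMinimal (t : BraceTree) : Prop :=
  ∀ s : BraceTree, s.val = t.val → ¬ List.Shortlex Letter.Precedes s.enc t.enc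

theorem exists_isMinimal (t : BraceTree) : ∃ s : BraceTree, s.val = t.val ∧ s.IsMinimal := by
  obtain ⟨s, hs, hmin⟩ := (InvImage.wf enc
    (List.Shortlex.wf Letter.wellFounded_precedes)).has_min {s | s.val = t.val} ⟨t, rfl⟩
  exact ⟨s, hs, fun u hu => hmin u (hu.trans hs)⟩

theorem IsMinimal.eq {s t : BraceTree} (hs : s.IsMinimal) (ht : t.IsMinimal) (h : s.val = t.val) :
    s = t :=
  enc_injective (Std.Trichotomous.trichotomous (r := List.Shortlex Letter.Precedes) _ _
    (ht s h) (hs t h.symm))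

theorem IsMinimal.isLeastEncoding {t : BraceTree} (ht : t.IsMinimal) :
    IsLeastEncoding t.enc t.val := by
  refine ⟨t.encodes_enc, fun v hv hne => ?_⟩
  obtain ⟨s, rfl, hs⟩ := hv.exists_tree
  by_contra h
  exact hne (Std.Trichotomous.trichotomous (r := List.Shortlex Letter.Precedes) _ _ (ht s hs) h)

theorem val_node_congr {ts ss : List BraceTree}
    (h : ∀ x, (∃ t ∈ ts, t.val = x) ↔ ∃ s ∈ ss, s.val = x) : (node ts).val = (node ss).val := by
  ext x
  simpa [mem_val] using h x

/-- A smaller encoding of a child could be substituted. For equal lengths the comparison survives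
the context because no tree word is a proper prefix of another. -/
theorem IsMinimal.child {s t : BraceTree} (h : t.IsMinimal) (hs : s ∈ t.children) : s.IsMinimal := by
  intro s' hval hlt
  obtain ⟨us, vs, e⟩ := List.append_of_mem hs
  have ht : t = node (us ++ s :: vs) := by rw [← e, node_children]
  subst ht
  refine h (node (us ++ s' :: vs)) (val_node_congr fun x => by simp [hval, or_and_right, exists_or]) ?_
  simp only [enc_node, List.flatMap_append, List.flatMap_cons, List.append_assoc]
  rcases List.shortlex_def.1 hlt with hl | ⟨hl, hlex⟩
  · exact .of_length_lt (by simp; omega)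
  · refine .of_lex (by simp; omega) (.cons (.append_left _ (hlex.append_of_not_prefix ?_ _ _) _))
    intro hp
    rw [eq_of_enc_prefix hp] at hlt
    exact asymm hlt hlt

theorem lex_or_lex {s t : BraceTree} (h : s ≠ t) :
    List.Lex Letter.Precedes s.enc t.enc ∨ List.Lex Letter.Precedes t.enc s.enc := by
  by_contra! hc
  exact h (enc_injective (Std.Trichotomous.trichotomous (r := List.Lex Letter.Precedes) _ _ hc.1 hc.2))

theorem IsMinimal.pairwise_lex {t : BraceTree} (h : t.IsMinimal) :
    t.children.Pairwise fun a b => List.Lex Letter.Precedes a.enc b.enc := by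
  refine List.pairwise_iff_forall_sublist.2 fun {a b} hab => ?_
  obtain ⟨r₁, r₂, e, ha, hb⟩ := List.cons_sublist_iff.1 hab
  obtain ⟨us, ms, rfl⟩ := List.append_of_mem ha
  obtain ⟨ns, vs, rfl⟩ := List.append_of_mem (List.singleton_sublist.1 hb)
  have ht : t = node (us ++ a :: (ms ++ ns ++ b :: vs)) := by
    rw [← node_children t, e]; simp
  generalize ms ++ ns = ms at ht
  subst ht
  by_contra hlt
  -- A repeated child can be deleted, which shortens the word; two distinct children in the wrong
  -- order can be swapped, which keeps the length and lowers the word lexicographically.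
  by_cases hne : a = b
  · subst hne
    refine h (node (us ++ a :: (ms ++ vs))) (val_node_congr fun x => ?_) ?_
    · constructor <;> (rintro ⟨t, ht, rfl⟩; refine ⟨t, ?_, rfl⟩; simp at ht ⊢; tauto)
    · have := length_enc_pos a
      simp only [enc_node]
      exact .of_length_lt (by simp; omega)
  · have hlex := (lex_or_lex hne).resolve_left hlt
    refine h (node (us ++ b :: (ms ++ a :: vs))) (val_node_congr fun x => ?_) ?_
    · constructor <;> (rintro ⟨t, ht, rfl⟩; refine ⟨t, ?_, rfl⟩; simp at ht ⊢; tauto)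
    · simp only [enc_node, List.flatMap_append, List.flatMap_cons, List.append_assoc]
      refine .of_lex (by simp; omega) (.cons (.append_left _ (hlex.append_of_not_prefix ?_ _ _) _))
      intro hp
      exact hne (eq_of_enc_prefix hp).symm

theorem lex_enc_append {s t : BraceTree} (h : s ≠ t) {x y : Word}
    (hl : List.Lex Letter.Precedes (s.enc ++ x) (t.enc ++ y)) :
    List.Lex Letter.Precedes s.enc t.enc :=
  hl.of_append (fun hp => h (eq_of_enc_prefix hp)) (fun hp => h (eq_of_enc_prefix hp).symm)

/-- After the common part the smaller word cannot close first, since `r` comes after `l`. So a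
proper extension of a list is smaller than the list, in accordance with `MinDiffLt`. -/
theorem exists_first_difference {ts ss : List BraceTree}
    (h : List.Lex Letter.Precedes (ts.flatMap enc ++ [Letter.r]) (ss.flatMap enc ++ [Letter.r])) :
    ∃ us t ts' ss', ts = us ++ t :: ts' ∧ ss = us ++ ss' ∧
      ∀ s ∈ ss'.head?, List.Lex Letter.Precedes t.enc s.enc := by
  induction ts generalizing ss with
  | nil =>
    cases ss with
    | nil => exact absurd h (irrefl _)
    | cons s ss =>
      simp only [enc, List.flatMap_nil, List.flatMap_cons, List.nil_append, List.cons_append] at h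
      cases h with
      | rel h => simp [Letter.Precedes] at h
  | cons t ts ih =>
    cases ss with
    | nil => exact ⟨[], t, ts, [], rfl, rfl, by simp⟩
    | cons s ss =>
      by_cases hts : t = s
      · subst hts
        simp only [List.flatMap_cons, List.append_assoc] at h
        obtain ⟨us, t', ts', ss', rfl, rfl, h'⟩ := ih (h.of_append_left)
        exact ⟨t :: us, t', ts', ss', rfl, rfl, h'⟩
      · refine ⟨[], t, ts, s :: ss, rfl, rfl, ?_⟩
        simp only [List.flatMap_cons, List.append_assoc] at h
        simpa using lex_enc_append hts h

/-- The first differing child `a` of `s` is the witness: the elements of `t` missing from `s` come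
from `bs`, whose trees are all lexicographically later than `a`, and induction on `a` applies. -/
theorem IsMinimal.minDiffLt {s t : BraceTree} (hs : s.IsMinimal) (ht : t.IsMinimal)
    (h : List.Lex Letter.Precedes s.enc t.enc) : MinDiffLt s.val t.val := by
  induction s using children_induction generalizing t with
  | h s ih =>
  rw [enc_eq, enc_eq t, List.lex_cons_iff] at h
  obtain ⟨us, a, as, bs, hs', ht', hab⟩ := exists_first_difference h
  have ha : a ∈ s.children := by simp [hs']
  have hlt : ∀ b ∈ bs, List.Lex Letter.Precedes a.enc b.enc := by
    intro b hb
    cases bs with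
    | nil => simp at hb
    | cons b' bs =>
      have hab := hab b' rfl
      rcases List.mem_cons.1 hb with rfl | hb
      · exact hab
      · have := ht.pairwise_lex
        rw [ht', List.pairwise_append, List.pairwise_cons] at this
        exact lex_precedes_trans hab (this.2.1.1 b hb)
  have hlt' : ∀ u ∈ us, List.Lex Letter.Precedes u.enc a.enc := by
    intro u hu
    have := hs.pairwise_lex
    rw [hs', List.pairwise_append] at this
    exact this.2.2 u hu a (by simp)
  refine ⟨val_mem_val ha, ?_, ?_⟩
  · intro hm
    obtain ⟨b, hb, e⟩ := mem_val.1 hm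
    -- Minimal trees with the same value coincide, so `a` itself would be listed in `t`, strictly
    -- before or strictly after itself.
    have hba : b = a := (ht.child hb).eq (hs.child ha) e
    subst hba
    rw [ht', List.mem_append] at hb
    rcases hb with hb | hb
    · exact irrefl _ (hlt' _ hb)
    · exact irrefl _ (hlt _ hb)
  · intro x hx hx'
    obtain ⟨b, hb, rfl⟩ := mem_val.1 hx
    refine ih a ha (hs.child ha) (ht.child hb) ?_
    rw [ht', List.mem_append] at hb
    rcases hb with hb | hb
    · exact absurd (val_mem_val (by simp [hs', hb])) hx'
    · exact hlt b hb

theorem IsMinimal.descendant {s t : BraceTree} (h : t.IsMinimal) (hs : t.Descendant s) :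
    s.IsMinimal := by
  induction hs with
  | refl => exact h
  | tail _ hc ih => exact ih.child hc

theorem IsMinimal.hereditarilySorted {t : BraceTree} (h : t.IsMinimal) : t.HereditarilySorted := by
  intro s hs
  have hm := h.descendant hs
  refine hm.pairwise_lex.imp_of_mem fun {a b} ha hb hab => ?_
  exact (hm.child ha).minDiffLt (hm.child hb) hab

end BraceTree

/-! ### Formulas and definability with size bounds -/

namespace MSO

namespace Formula

/-- The extension of a renaming of variables to the body of a quantifier. -/
def liftRen {k k' : ℕ} (g : Fin k → Fin k') : Fin (k + 1) → Fin (k' + 1) :=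
  Fin.cons 0 (Fin.succ ∘ g)

theorem cons_comp_liftRen {α : Type*} {k k' : ℕ} (g : Fin k → Fin k') (a : α) (p : Fin k' → α) :
    (Fin.cons a p : Fin (k' + 1) → α) ∘ liftRen g = Fin.cons a (p ∘ g) := by
  funext i
  refine Fin.cases ?_ (fun i => ?_) i <;> simp [liftRen]

/-- Renaming of the free variables of a formula. -/
def rename {m k : ℕ} : Formula m k → {m' k' : ℕ} → (Fin m → Fin m') → (Fin k → Fin k') → Formula m' k'
  | eq x y, _, _, _, g => eq (g x) (g y)
  | lt x y, _, _, _, g => lt (g x) (g y)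
  | letter a x, _, _, _, g => letter a (g x)
  | mem U x, _, _, f, g => mem (f U) (g x)
  | neg φ, _, _, f, g => neg (φ.rename f g)
  | and φ ψ, _, _, f, g => and (φ.rename f g) (ψ.rename f g)
  | or φ ψ, _, _, f, g => or (φ.rename f g) (ψ.rename f g)
  | ex φ, _, _, f, g => ex (φ.rename f (liftRen g))
  | all φ, _, _, f, g => all (φ.rename f (liftRen g))
  | exSet φ, _, _, f, g => exSet (φ.rename (liftRen f) g)
  | allSet φ, _, _, f, g => allSet (φ.rename (liftRen f) g)

theorem size_rename {m k : ℕ} (φ : Formula m k) {m' k' : ℕ} (f : Fin m → Fin m')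
    (g : Fin k → Fin k') : (φ.rename f g).size = φ.size := by
  induction φ generalizing m' k' <;> simp_all [rename, size]

theorem sat_rename {m k : ℕ} (φ : Formula m k) {m' k' : ℕ} (f : Fin m → Fin m')
    (g : Fin k → Fin k') (w : Word) (P : Fin m' → Set (Fin w.length)) (p : Fin k' → Fin w.length) :
    (φ.rename f g).Sat w P p ↔ φ.Sat w (P ∘ f) (p ∘ g) := by
  induction φ generalizing m' k' <;> simp_all [rename, Sat, cons_comp_liftRen]

theorem size_pos {m k : ℕ} (φ : Formula m k) : 0 < φ.size := by
  cases φ <;> simp [size]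

/-- Makes the suprema in `DN`, `LS` and `H` genuine maxima, since `sSup` of an unbounded set of
naturals is `0`. The induction needs all `m`, `k` at once because quantifiers add variables. -/
theorem finite_setOf_size_le (n : ℕ) : ∀ m k : ℕ, {φ : Formula m k | φ.size ≤ n}.Finite := by
  have : Finite Letter := Finite.of_surjective (fun b : Bool => if b then Letter.l else Letter.r)
    (by rintro (_ | _); exacts [⟨true, rfl⟩, ⟨false, rfl⟩])
  induction n with
  | zero => exact fun m k => Set.finite_empty.subset fun φ h => absurd h (by simpa using φ.size_pos.ne')
  | succ n ih =>
    intro m k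
    refine Set.Finite.subset
      (((((((((((Set.finite_range fun x : Fin k × Fin k => (eq x.1 x.2 : Formula m k)).union
      (Set.finite_range fun x : Fin k × Fin k => (lt x.1 x.2 : Formula m k))).union
      (Set.finite_range fun x : Letter × Fin k => (letter x.1 x.2 : Formula m k))).union
      (Set.finite_range fun x : Fin m × Fin k => (mem x.1 x.2 : Formula m k))).union
      ((ih m k).image neg)).union
      ((ih m k).image2 and (ih m k))).union
      ((ih m k).image2 or (ih m k))).union
      ((ih m (k + 1)).image ex)).union
      ((ih m (k + 1)).image all)).union
      ((ih (m + 1) k).image exSet)).union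
      ((ih (m + 1) k).image allSet)) ?_
    intro φ hφ
    simp only [Set.mem_union, Set.mem_range, Set.mem_image, Set.mem_image2, Prod.exists,
      Set.mem_ofPred_eq] at hφ ⊢
    cases φ with
    | eq | lt | letter | mem => simp
    | and φ ψ | or φ ψ =>
      have := φ.size_pos
      have := ψ.size_pos
      simp only [size] at hφ
      have h₁ : φ.size ≤ n := by omega
      have h₂ : ψ.size ≤ n := by omega
      simp [h₁, h₂]
    | neg φ | ex φ | all φ | exSet φ | allSet φ =>
      simp only [size] at hφ
      have h₁ : φ.size ≤ n := by omega
      simp [h₁]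

end Formula

/-- The relation `R` between sets of positions and positions is defined in every word by one formula
of size at most `s`. -/
def IsDefinable {m k : ℕ} (s : ℕ)
    (R : ∀ w : Word, (Fin m → Set (Fin w.length)) → (Fin k → Fin w.length) → Prop) : Prop :=
  ∃ φ : Formula m k, φ.size ≤ s ∧ ∀ w P p, φ.Sat w P p ↔ R w P p

namespace IsDefinable

variable {m k s t : ℕ}
  {R S : ∀ w : Word, (Fin m → Set (Fin w.length)) → (Fin k → Fin w.length) → Prop}

theorem of_iff (h : IsDefinable s R) (hst : s ≤ t) (hRS : ∀ w P p, R w P p ↔ S w P p) :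
    IsDefinable t S := by
  obtain ⟨φ, hs, hφ⟩ := h
  exact ⟨φ, hs.trans hst, fun w P p => (hφ w P p).trans (hRS w P p)⟩

theorem eq (i j : Fin k) : IsDefinable (m := m) 1 (fun _ _ p => p i = p j) :=
  ⟨.eq i j, le_rfl, fun _ _ _ => Iff.rfl⟩

theorem lt (i j : Fin k) : IsDefinable (m := m) 1 (fun _ _ p => p i < p j) :=
  ⟨.lt i j, le_rfl, fun _ _ _ => Iff.rfl⟩

theorem letter (a : Letter) (i : Fin k) : IsDefinable (m := m) 1 (fun w _ p => w.get (p i) = a) :=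
  ⟨.letter a i, le_rfl, fun _ _ _ => Iff.rfl⟩

theorem mem (U : Fin m) (i : Fin k) : IsDefinable 1 (fun _ P p => p i ∈ P U) :=
  ⟨.mem U i, le_rfl, fun _ _ _ => Iff.rfl⟩

theorem not (h : IsDefinable s R) : IsDefinable (s + 1) (fun w P p => ¬ R w P p) := by
  obtain ⟨φ, hs, hφ⟩ := h
  exact ⟨.neg φ, Nat.succ_le_succ hs, fun w P p => not_congr (hφ w P p)⟩

theorem and (h : IsDefinable s R) (h' : IsDefinable t S) :
    IsDefinable (s + t + 1) (fun w P p => R w P p ∧ S w P p) := by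
  obtain ⟨φ, hs, hφ⟩ := h
  obtain ⟨ψ, ht, hψ⟩ := h'
  exact ⟨.and φ ψ, by simp only [Formula.size]; omega, fun w P p => and_congr (hφ w P p) (hψ w P p)⟩

theorem or (h : IsDefinable s R) (h' : IsDefinable t S) :
    IsDefinable (s + t + 1) (fun w P p => R w P p ∨ S w P p) := by
  obtain ⟨φ, hs, hφ⟩ := h
  obtain ⟨ψ, ht, hψ⟩ := h'
  exact ⟨.or φ ψ, by simp only [Formula.size]; omega, fun w P p => or_congr (hφ w P p) (hψ w P p)⟩

theorem imp (h : IsDefinable s R) (h' : IsDefinable t S) :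
    IsDefinable (s + t + 2) (fun w P p => R w P p → S w P p) :=
  (h.not.or h').of_iff (by omega) fun _ _ _ => imp_iff_not_or.symm

theorem ex {R : ∀ w : Word, (Fin m → Set (Fin w.length)) → (Fin (k + 1) → Fin w.length) → Prop}
    (h : IsDefinable s R) : IsDefinable (s + 1) (fun w P p => ∃ a, R w P (Fin.cons a p)) := by
  obtain ⟨φ, hs, hφ⟩ := h
  exact ⟨.ex φ, Nat.succ_le_succ hs, fun w P p => exists_congr fun a => hφ w P _⟩

theorem all {R : ∀ w : Word, (Fin m → Set (Fin w.length)) → (Fin (k + 1) → Fin w.length) → Prop}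
    (h : IsDefinable s R) : IsDefinable (s + 1) (fun w P p => ∀ a, R w P (Fin.cons a p)) := by
  obtain ⟨φ, hs, hφ⟩ := h
  exact ⟨.all φ, Nat.succ_le_succ hs, fun w P p => forall_congr' fun a => hφ w P _⟩

theorem allSet
    {R : ∀ w : Word, (Fin (m + 1) → Set (Fin w.length)) → (Fin k → Fin w.length) → Prop}
    (h : IsDefinable s R) : IsDefinable (s + 1) (fun w P p => ∀ A, R w (Fin.cons A P) p) := by
  obtain ⟨φ, hs, hφ⟩ := h
  exact ⟨.allSet φ, Nat.succ_le_succ hs, fun w P p => forall_congr' fun a => hφ w _ p⟩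

theorem rename (h : IsDefinable s R) {m' k' : ℕ} (f : Fin m → Fin m') (g : Fin k → Fin k') :
    IsDefinable s (fun w P p => R w (P ∘ f) (p ∘ g)) := by
  obtain ⟨φ, hs, hφ⟩ := h
  exact ⟨φ.rename f g, (φ.size_rename f g).trans_le hs,
    fun w P p => (φ.sat_rename f g w P p).trans (hφ w _ _)⟩

end IsDefinable

/-- The property `R` of positions is definable by a formula of size at most `s`. -/
def IsDefinable₁ (s : ℕ) (R : ∀ w : Word, Fin w.length → Prop) : Prop :=
  IsDefinable (m := 0) (k := 1) s fun w _ p => R w (p 0)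

/-- The binary relation `R` between positions is definable by a formula of size at most `s`. -/
def IsDefinable₂ (s : ℕ) (R : ∀ w : Word, Fin w.length → Fin w.length → Prop) : Prop :=
  IsDefinable (m := 0) (k := 2) s fun w _ p => R w (p 0) (p 1)

/-- The ternary relation `R` between positions is definable by a formula of size at most `s`. -/
def IsDefinable₃ (s : ℕ) (R : ∀ w : Word, Fin w.length → Fin w.length → Fin w.length → Prop) :
    Prop :=
  IsDefinable (m := 0) (k := 3) s fun w _ p => R w (p 0) (p 1) (p 2)

/-- Substitution of variables leaves the size unchanged, and a relation without set parameters may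
be used under any set quantifiers. -/
theorem IsDefinable₁.app {s : ℕ} {R : ∀ w : Word, Fin w.length → Prop}
    (h : IsDefinable₁ s R) {m k : ℕ} (i : Fin k) :
    IsDefinable (m := m) s fun w _ p => R w (p i) :=
  h.rename Fin.elim0 ![i]

theorem IsDefinable₂.app {s : ℕ} {R : ∀ w : Word, Fin w.length → Fin w.length → Prop}
    (h : IsDefinable₂ s R) {m k : ℕ} (i j : Fin k) :
    IsDefinable (m := m) s fun w _ p => R w (p i) (p j) :=
  h.rename Fin.elim0 ![i, j]

theorem IsDefinable₃.app {s : ℕ}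
    {R : ∀ w : Word, Fin w.length → Fin w.length → Fin w.length → Prop}
    (h : IsDefinable₃ s R) {m k : ℕ} (i j l : Fin k) :
    IsDefinable (m := m) s fun w _ p => R w (p i) (p j) (p l) :=
  h.rename Fin.elim0 ![i, j, l]

theorem reflTransGen_iff_forall_set {α : Type*} {r : α → α → Prop} {x y : α} :
    Relation.ReflTransGen r x y ↔
      ∀ A : Set α, (x ∈ A ∧ ∀ z d, (z ∈ A ∧ r z d) → d ∈ A) → y ∈ A := by
  constructor
  · rintro h A ⟨hx, hA⟩
    induction h with
    | refl => exact hx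
    | tail _ hr ih => exact hA _ _ ⟨ih, hr⟩
  · intro h
    exact h {z | Relation.ReflTransGen r x z} ⟨.refl, fun z d hz => hz.1.tail hz.2⟩

/-- The relation is used only once, so iterating this construction adds a constant each time instead
of multiplying the size. -/
theorem IsDefinable₂.reflTransGen {s : ℕ} {R : ∀ w : Word, Fin w.length → Fin w.length → Prop}
    (h : IsDefinable₂ s R) :
    IsDefinable₂ (s + 13) (fun w => Relation.ReflTransGen (R w)) := by
  refine IsDefinable.of_iff (m := 0) (k := 2)
    (.allSet (.imp (.and (.mem 0 0) (.all (.all (.imp (.and (.mem 0 1) (h.app 1 0)) (.mem 0 0)))))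
      (.mem 0 1))) (by omega) ?_
  intro w P p
  exact reflTransGen_iff_forall_set.symm

/-- `succ a b` states that `b` is the position after `a`. -/
theorem isDefinable₂_succ : IsDefinable₂ 7 (fun _ a b => (b : ℕ) = a + 1) := by
  refine IsDefinable.of_iff (m := 0) (k := 2)
    (.and (.lt 0 1) (.not (.ex (.and (.lt 1 0) (.lt 0 2))))) (by omega) ?_
  intro w P p
  show (p 0 < p 1 ∧ ¬ ∃ c, p 0 < c ∧ c < p 1) ↔ _
  constructor
  · rintro ⟨h₁, h₂⟩
    by_contra hne
    have h₁' : (p 0 : ℕ) < p 1 := h₁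
    exact h₂ ⟨⟨p 0 + 1, by omega⟩, Nat.lt_succ_self _, Fin.lt_def.2 (by dsimp only; omega)⟩
  · intro h
    refine ⟨Fin.lt_def.2 (by omega), ?_⟩
    rintro ⟨c, hc, hc'⟩
    simp only [Fin.lt_def] at hc hc'
    omega

theorem isDefinable₁_first : IsDefinable₁ 3 (fun _ a => (a : ℕ) = 0) := by
  refine IsDefinable.of_iff (m := 0) (k := 1) (.not (.ex (.lt 0 1))) (by omega) ?_
  intro w P p
  show (¬ ∃ c, c < p 0) ↔ _
  constructor
  · intro h
    by_contra hne
    exact h ⟨⟨0, by omega⟩, Fin.lt_def.2 (by dsimp only; omega)⟩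
  · rintro h ⟨c, hc⟩
    simp only [Fin.lt_def] at hc
    omega

theorem isDefinable₁_last : IsDefinable₁ 3 (fun w a => (a : ℕ) + 1 = w.length) := by
  refine IsDefinable.of_iff (m := 0) (k := 1) (.not (.ex (.lt 1 0))) (by omega) ?_
  intro w P p
  show (¬ ∃ c, p 0 < c) ↔ _
  constructor
  · intro h
    by_contra hne
    exact h ⟨⟨p 0 + 1, by omega⟩, Nat.lt_succ_self _⟩
  · rintro h ⟨c, hc⟩
    simp only [Fin.lt_def] at hc
    omega

end MSO

/-! ### Finite levels of the cumulative hierarchy -/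

/-- The finite levels of the von Neumann hierarchy. -/
noncomputable def finiteLevel (i : ℕ) : ZFSet.{0} := ZFSet.vonNeumann (i : Ordinal.{0})

theorem finiteLevel_zero : finiteLevel 0 = ∅ := by simp [finiteLevel]

theorem mem_finiteLevel_succ {i : ℕ} {x : ZFSet} :
    x ∈ finiteLevel (i + 1) ↔ ∀ y ∈ x, y ∈ finiteLevel i := by
  rw [finiteLevel, Nat.cast_add, Nat.cast_one, ZFSet.vonNeumann_add_one, ZFSet.mem_powerset]
  exact Iff.rfl

theorem finiteLevel_mono {i j : ℕ} (h : i ≤ j) {x : ZFSet} (hx : x ∈ finiteLevel i) :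
    x ∈ finiteLevel j :=
  ZFSet.vonNeumann_subset_of_le (Nat.cast_le.2 h) hx

theorem mem_finiteLevel_of_mem {i : ℕ} {x y : ZFSet} (hx : x ∈ finiteLevel (i + 1)) (hy : y ∈ x) :
    y ∈ finiteLevel i := mem_finiteLevel_succ.1 hx y hy

theorem BraceTree.val_mem_finiteLevel_succ {i : ℕ} {t : BraceTree} :
    t.val ∈ finiteLevel (i + 1) ↔ ∀ s ∈ t.children, s.val ∈ finiteLevel i := by
  rw [mem_finiteLevel_succ]
  constructor
  · exact fun h s hs => h _ (BraceTree.val_mem_val hs)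
  · intro h y hy
    obtain ⟨s, hs, rfl⟩ := BraceTree.mem_val.1 hy
    exact h s hs

/-! ### Nodes as positions of a word -/

namespace MSO

open Relation BraceTree

/-- The word of the tree `t` occurs in `w` at the position `a`. -/
def StartsAt (w : Word) (a : Fin w.length) (t : BraceTree) : Prop := t.enc <+: w.drop a

/-- The letters of `w` after position `z` up to `d` are the word of a tree that represents an element
of level `j` of the von Neumann hierarchy. -/
def Block (j : ℕ) (w : Word) (z d : Fin w.length) : Prop :=
  ∃ t : BraceTree, t.val ∈ finiteLevel j ∧ w.drop (z + 1) = t.enc ++ w.drop (d + 1)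

variable {w : Word}

theorem drop_eq_get_cons (a : Fin w.length) : w.drop a = w.get a :: w.drop (a + 1) := by
  simp [List.get_eq_getElem]

theorem eq_add_length_of_drop_eq {a b : ℕ} {u : Word} (ha : a ≤ w.length) (hb : b ≤ w.length)
    (h : w.drop a = u ++ w.drop b) : b = a + u.length := by
  have := congrArg List.length h
  simp at this
  omega

theorem drop_add_of_drop_eq {a : ℕ} {u v : Word} (h : w.drop a = u ++ v) :
    w.drop (a + u.length) = v := by
  rw [← List.drop_drop, h, List.drop_left]

theorem add_length_le_of_drop_eq {a : ℕ} {u v : Word} (ha : a ≤ w.length) (h : w.drop a = u ++ v) :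
    a + u.length + v.length = w.length := by
  have := congrArg List.length h
  simp at this
  omega

/-- A block is the half-open interval after `z` up to `d`, so adjacent blocks share an endpoint and
concatenation of tree words becomes composition of relations. -/
theorem reflTransGen_block {j : ℕ} {c e : Fin w.length} :
    ReflTransGen (Block j w) c e ↔ ∃ ts : List BraceTree, (∀ t ∈ ts, t.val ∈ finiteLevel j) ∧
      w.drop (c + 1) = ts.flatMap enc ++ w.drop (e + 1) := by
  constructor
  · intro h
    induction h using ReflTransGen.head_induction_on with
    | refl => exact ⟨[], by simp, by simp⟩
    | head h _ ih =>
      obtain ⟨t, ht, h⟩ := h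
      obtain ⟨ts, hts, h'⟩ := ih
      exact ⟨t :: ts, by simpa using ⟨ht, hts⟩, by simp [h, h']⟩
  · rintro ⟨ts, hts, h⟩
    induction ts generalizing c with
    | nil =>
      have := eq_add_length_of_drop_eq (by omega) (by omega) h
      have : c = e := Fin.ext (by simpa using this.symm)
      exact this ▸ .refl
    | cons t ts ih =>
      rw [List.flatMap_cons, List.append_assoc] at h
      have hlen := add_length_le_of_drop_eq (by omega) h
      have hpos := t.length_enc_pos
      have hd := drop_add_of_drop_eq h
      let d : Fin w.length := ⟨c + t.enc.length, by omega⟩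
      have hd' : w.drop (d + 1) = ts.flatMap enc ++ w.drop (e + 1) := by
        rw [← hd]; congr 1; simp [d]; omega
      exact .head ⟨t, hts t (by simp), by rw [hd', h]⟩ (ih (fun s hs => hts s (by simp [hs])) hd')

theorem block_zero {z d : Fin w.length} : ¬ Block 0 w z d := by
  rintro ⟨t, ht, -⟩
  rw [finiteLevel_zero] at ht
  exact ZFSet.notMem_empty _ ht

theorem block_succ {j : ℕ} {z d : Fin w.length} : Block (j + 1) w z d ↔
    ∃ c e : Fin w.length, (c : ℕ) = z + 1 ∧ w.get c = Letter.l ∧ ReflTransGen (Block j w) c e ∧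
      (d : ℕ) = e + 1 ∧ w.get d = Letter.r := by
  constructor
  · rintro ⟨t, ht, h⟩
    rw [enc_eq] at h
    have hlen := add_length_le_of_drop_eq (by omega) h
    have hd := eq_add_length_of_drop_eq (by omega) (by omega) h
    simp only [List.length_cons, List.length_append, List.length_nil, zero_add] at hlen hd
    let c : Fin w.length := ⟨z + 1, by omega⟩
    let e : Fin w.length := ⟨d - 1, by omega⟩
    have hc := (drop_eq_get_cons c).symm.trans h
    rw [List.cons_append, List.cons.injEq] at hc
    have he : (d : ℕ) = e + 1 := by simp [e]; omega
    have h' : w.drop (z + 1 + 1) = t.children.flatMap enc ++ (Letter.r :: w.drop (d + 1)) := by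
      simpa using hc.2
    have h₃ := drop_add_of_drop_eq h'
    rw [show (z : ℕ) + 1 + 1 + (t.children.flatMap enc).length = d by omega, drop_eq_get_cons,
      List.cons.injEq] at h₃
    refine ⟨c, e, rfl, hc.1, ?_, he, h₃.1⟩
    refine reflTransGen_block.2 ⟨_, val_mem_finiteLevel_succ.1 ht, ?_⟩
    rw [← he, drop_eq_get_cons d, h₃.1]
    exact h'
  · rintro ⟨c, e, hc, hl, h, he, hr⟩
    obtain ⟨ts, hts, h⟩ := reflTransGen_block.1 h
    refine ⟨node ts, val_mem_finiteLevel_succ.2 (by simpa using hts), ?_⟩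
    rw [← hc, drop_eq_get_cons c, h, hl, ← he, drop_eq_get_cons d, hr, enc_node]
    simp

/-- The position `c` is the start of a child of the node that starts at `a`. -/
def Child (i : ℕ) (w : Word) (a c : Fin w.length) : Prop :=
  w.get c = Letter.l ∧ ∃ e, ReflTransGen (Block i w) a e ∧ (c : ℕ) = e + 1

theorem StartsAt.eq {a : Fin w.length} {s t : BraceTree} (hs : StartsAt w a s)
    (ht : StartsAt w a t) : s = t := by
  obtain ⟨x, hx⟩ := hs
  obtain ⟨y, hy⟩ := ht
  exact (enc_append_inj (hx.trans hy.symm)).1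

theorem StartsAt.drop_succ {a : Fin w.length} {t : BraceTree} (h : StartsAt w a t) :
    ∃ y, w.drop (a + 1) = t.children.flatMap enc ++ Letter.r :: y := by
  obtain ⟨y, hy⟩ := h
  rw [enc_eq, drop_eq_get_cons, List.cons_append, List.cons.injEq] at hy
  exact ⟨y, by rw [← hy.2]; simp⟩

/-- The bound on `t.val` places all children in level `i`, so that each of them is recognised as a
block. -/
theorem StartsAt.child_iff {i : ℕ} {a c : Fin w.length} {t : BraceTree} (h : StartsAt w a t)
    (ht : t.val ∈ finiteLevel (i + 1)) : Child i w a c ↔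
      ∃ us s vs, t.children = us ++ s :: vs ∧ (c : ℕ) = a + 1 + (us.flatMap enc).length ∧
        StartsAt w c s := by
  obtain ⟨y, hy⟩ := h.drop_succ
  have key : ∀ us s vs, t.children = us ++ s :: vs →
      (c : ℕ) = a + 1 + (us.flatMap enc).length → StartsAt w c s := by
    intro us s vs hus hc
    rw [hus, List.flatMap_append, List.append_assoc] at hy
    rw [StartsAt, hc, drop_add_of_drop_eq hy]
    simp
  constructor
  · rintro ⟨hl, e, he, hc⟩
    obtain ⟨us, -, hus⟩ := reflTransGen_block.1 he
    have hlen := eq_add_length_of_drop_eq (by omega) (by omega) hus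
    rw [← hc, drop_eq_get_cons c, hl, hy] at hus
    obtain ⟨s, vs, hs⟩ := prefix_of_flatMap_enc hus.symm
    exact ⟨us, s, vs, hs, by omega, key us s vs hs (by omega)⟩
  · rintro ⟨us, s, vs, hs, hc, hst⟩
    refine ⟨?_, ⟨c - 1, by omega⟩, ?_, by simp; omega⟩
    · obtain ⟨x, hx⟩ := hst
      rw [drop_eq_get_cons, enc, List.cons_append, List.cons.injEq] at hx
      exact hx.1.symm
    · refine reflTransGen_block.2 ⟨us, fun u hu => val_mem_finiteLevel_succ.1 ht u (by simp [hs, hu]), ?_⟩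
      have hy' := hy
      rw [hs, List.flatMap_append, List.append_assoc] at hy'
      rw [show (c : ℕ) - 1 + 1 = c by omega, hc, drop_add_of_drop_eq hy']
      exact hy'

theorem StartsAt.of_child {i : ℕ} {a c : Fin w.length} {t : BraceTree} (h : StartsAt w a t)
    (ht : t.val ∈ finiteLevel (i + 1)) (hc : Child i w a c) : ∃ s ∈ t.children, StartsAt w c s := by
  obtain ⟨us, s, vs, e, -, hs⟩ := (h.child_iff ht).1 hc
  exact ⟨s, by simp [e], hs⟩

theorem StartsAt.exists_position {i : ℕ} {a : Fin w.length} {t : BraceTree} (h : StartsAt w a t)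
    (ht : t.val ∈ finiteLevel (i + 1)) {us vs : List BraceTree} {s : BraceTree}
    (hs : t.children = us ++ s :: vs) :
    ∃ c : Fin w.length, (c : ℕ) = a + 1 + (us.flatMap enc).length ∧ Child i w a c ∧
      StartsAt w c s := by
  obtain ⟨y, hy⟩ := h.drop_succ
  rw [hs, List.flatMap_append, List.append_assoc] at hy
  have hlen := add_length_le_of_drop_eq (by omega) hy
  have hpos := s.length_enc_pos
  simp only [List.flatMap_cons, List.length_append] at hlen
  have hd := drop_add_of_drop_eq hy
  let c : Fin w.length := ⟨a + 1 + (us.flatMap enc).length, by omega⟩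
  have hc : StartsAt w c s := by
    rw [StartsAt, show (c : ℕ) = a + 1 + (us.flatMap enc).length from rfl, hd]
    simp
  exact ⟨c, rfl, (h.child_iff ht).2 ⟨us, s, vs, hs, rfl, hc⟩, hc⟩

theorem StartsAt.exists_child {i : ℕ} {a : Fin w.length} {s t : BraceTree} (h : StartsAt w a t)
    (ht : t.val ∈ finiteLevel (i + 1)) (hs : s ∈ t.children) :
    ∃ c, Child i w a c ∧ StartsAt w c s := by
  obtain ⟨us, vs, e⟩ := List.append_of_mem hs
  obtain ⟨c, -, hc⟩ := h.exists_position ht e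
  exact ⟨c, hc⟩

theorem StartsAt.sublist_of_lt {i : ℕ} {a c d : Fin w.length} {t : BraceTree} (h : StartsAt w a t)
    (ht : t.val ∈ finiteLevel (i + 1)) (hc : Child i w a c) (hd : Child i w a d) (hlt : c < d) :
    ∃ p q, [p, q].Sublist t.children ∧ StartsAt w c p ∧ StartsAt w d q := by
  obtain ⟨us, p, vs, e, hc, hp⟩ := (h.child_iff ht).1 hc
  obtain ⟨us', q, vs', e', hd, hq⟩ := (h.child_iff ht).1 hd
  refine ⟨p, q, ?_, hp, hq⟩
  have hlt' : (us.flatMap enc).length < (us'.flatMap enc).length := by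
    rw [Fin.lt_def] at hlt; omega
  rw [e] at e'
  rcases List.append_eq_append_iff.1 e' with ⟨ms, rfl, hms⟩ | ⟨ms, rfl, -⟩
  · cases ms with
    | nil => simp at hlt'
    | cons m ms =>
      simp only [List.cons_append, List.cons.injEq] at hms
      rw [e, hms.2, List.cons_sublist_iff]
      exact ⟨us ++ [p], ms ++ q :: vs', by simp, by simp, by simp⟩
  · simp at hlt'

theorem StartsAt.exists_lt_of_sublist {i : ℕ} {a : Fin w.length} {p q t : BraceTree}
    (h : StartsAt w a t) (ht : t.val ∈ finiteLevel (i + 1)) (hpq : [p, q].Sublist t.children) :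
    ∃ c d, Child i w a c ∧ Child i w a d ∧ c < d ∧ StartsAt w c p ∧ StartsAt w d q := by
  obtain ⟨r₁, r₂, e, ha, hb⟩ := List.cons_sublist_iff.1 hpq
  obtain ⟨us, ms, rfl⟩ := List.append_of_mem ha
  obtain ⟨ns, vs, rfl⟩ := List.append_of_mem (List.singleton_sublist.1 hb)
  obtain ⟨c, hc, hc', hp⟩ := h.exists_position ht
    (show t.children = us ++ p :: (ms ++ (ns ++ q :: vs)) by simp [e])
  obtain ⟨d, hd, hd', hq⟩ := h.exists_position ht
    (show t.children = (us ++ p :: (ms ++ ns)) ++ q :: vs by simp [e])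
  refine ⟨c, d, hc', hd', Fin.lt_def.2 ?_, hp, hq⟩
  have := p.length_enc_pos
  simp only [List.flatMap_append, List.flatMap_cons, List.length_append] at hd
  omega

/-- The nodes that start at `x` and `y` represent the same set of level `j`. -/
def SameVal (i : ℕ) : ℕ → ∀ w : Word, Fin w.length → Fin w.length → Prop
  | 0, _, _, _ => True
  | j + 1, w, x, y => ∀ x', (Child i w x x' ∨ Child i w y x') →
      ∃ y', ((Child i w x x' ∧ Child i w y y') ∨ (Child i w y x' ∧ Child i w x y')) ∧
        SameVal i j w x' y'

/-- `SameVal` merges the two inclusions of extensionality into one quantifier over the children of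
both nodes, so that it calls itself only once. At level `0` there is nothing to compare, as no tree
has its value in the empty level. -/
theorem sameVal_iff {i j : ℕ} (hj : j ≤ i + 1) {x y : Fin w.length} {s t : BraceTree}
    (hx : StartsAt w x s) (hy : StartsAt w y t) (hs : s.val ∈ finiteLevel j)
    (ht : t.val ∈ finiteLevel j) : SameVal i j w x y ↔ s.val = t.val := by
  induction j generalizing x y s t with
  | zero => rw [finiteLevel_zero] at hs; exact absurd hs (ZFSet.notMem_empty _)
  | succ j ih =>
    have hs' := finiteLevel_mono hj hs
    have ht' := finiteLevel_mono hj ht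
    have ls := val_mem_finiteLevel_succ.1 hs
    have lt := val_mem_finiteLevel_succ.1 ht
    rw [val_eq_iff, SameVal]
    constructor
    · intro h
      constructor
      · intro a ha
        obtain ⟨x', hx', hxa⟩ := hx.exists_child hs' ha
        obtain ⟨y', ⟨-, h'⟩ | ⟨h', -⟩, hv⟩ := h x' (.inl hx')
        · obtain ⟨b, hb, hyb⟩ := hy.of_child ht' h'
          exact ⟨b, hb, (ih (by omega) hxa hyb (ls a ha) (lt b hb)).1 hv⟩
        -- Here `x'` is a child of both nodes, so its own tree is the required match.
        · obtain ⟨b, hb, hyb⟩ := hy.of_child ht' h'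
          exact ⟨b, hb, by rw [hxa.eq hyb]⟩
      · intro b hb
        obtain ⟨x', hx', hxb⟩ := hy.exists_child ht' hb
        obtain ⟨y', ⟨h', -⟩ | ⟨-, h'⟩, hv⟩ := h x' (.inr hx')
        · obtain ⟨a, ha, hxa⟩ := hx.of_child hs' h'
          exact ⟨a, ha, by rw [hxa.eq hxb]⟩
        · obtain ⟨a, ha, hya⟩ := hx.of_child hs' h'
          exact ⟨a, ha, (ih (by omega) hxb hya (lt b hb) (ls a ha)).1 hv⟩
    · rintro ⟨h₁, h₂⟩ x' (hx' | hx')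
      · obtain ⟨a, ha, hxa⟩ := hx.of_child hs' hx'
        obtain ⟨b, hb, e⟩ := h₁ a ha
        obtain ⟨y', hy', hyb⟩ := hy.exists_child ht' hb
        exact ⟨y', .inl ⟨hx', hy'⟩, (ih (by omega) hxa hyb (ls a ha) (lt b hb)).2 e⟩
      · obtain ⟨b, hb, hxb⟩ := hy.of_child ht' hx'
        obtain ⟨a, ha, e⟩ := h₂ b hb
        obtain ⟨y', hy', hya⟩ := hx.exists_child hs' ha
        exact ⟨y', .inr ⟨hx', hy'⟩, (ih (by omega) hxb hya (lt b hb) (ls a ha)).2 e⟩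

/-- The node that starts at `z` represents an element of the set that is represented at `y`. -/
def MemVal (i : ℕ) (w : Word) (z y : Fin w.length) : Prop :=
  ∃ u, Child i w y u ∧ SameVal i i w z u

theorem memVal_iff {i : ℕ} {z y : Fin w.length} {s t : BraceTree} (hz : StartsAt w z s)
    (hy : StartsAt w y t) (hs : s.val ∈ finiteLevel i) (ht : t.val ∈ finiteLevel (i + 1)) :
    MemVal i w z y ↔ s.val ∈ t.val := by
  have lt := val_mem_finiteLevel_succ.1 ht
  rw [mem_val]
  constructor
  · rintro ⟨u, hu, h⟩
    obtain ⟨b, hb, hub⟩ := hy.of_child ht hu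
    exact ⟨b, hb, ((sameVal_iff (by omega) hz hub hs (lt b hb)).1 h).symm⟩
  · rintro ⟨b, hb, e⟩
    obtain ⟨u, hu, hub⟩ := hy.exists_child ht hb
    exact ⟨u, hu, (sameVal_iff (by omega) hz hub hs (lt b hb)).2 e.symm⟩

/-- Among the children of the node at `a`, a representation of the set at `z` precedes one of the set
at `u`. -/
def Before (i : ℕ) (w : Word) (a z u : Fin w.length) : Prop :=
  ∃ p q, (Child i w a p ∧ Child i w a q ∧ p < q) ∧ SameVal i i w p z ∧ SameVal i i w q u

/-- Among the children of the root of `T`, a representation of `x` precedes one of `y`. -/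
def ListedBefore (T : BraceTree) (x y : ZFSet.{0}) : Prop :=
  ∃ p q, [p, q].Sublist T.children ∧ p.val = x ∧ q.val = y

theorem before_iff {i : ℕ} {a z u : Fin w.length} {s t T : BraceTree} (ha : StartsAt w a T)
    (hT : T.val ∈ finiteLevel (i + 1)) (hz : StartsAt w z s) (hu : StartsAt w u t)
    (hs : s.val ∈ finiteLevel i) (ht : t.val ∈ finiteLevel i) :
    Before i w a z u ↔ ListedBefore T s.val t.val := by
  have lT := val_mem_finiteLevel_succ.1 hT
  constructor
  · rintro ⟨c, d, ⟨hc, hd, hlt⟩, h₁, h₂⟩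
    obtain ⟨p, q, hpq, hp, hq⟩ := ha.sublist_of_lt hT hc hd hlt
    exact ⟨p, q, hpq, (sameVal_iff (by omega) hp hz (lT p (hpq.subset (by simp))) hs).1 h₁,
      (sameVal_iff (by omega) hq hu (lT q (hpq.subset (by simp))) ht).1 h₂⟩
  · rintro ⟨p, q, hpq, h₁, h₂⟩
    obtain ⟨c, d, hc, hd, hlt, hp, hq⟩ := ha.exists_lt_of_sublist hT hpq
    exact ⟨c, d, ⟨hc, hd, hlt⟩,
      (sameVal_iff (by omega) hp hz (lT p (hpq.subset (by simp))) hs).2 h₁,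
      (sameVal_iff (by omega) hq hu (lT q (hpq.subset (by simp))) ht).2 h₂⟩

/-- The children of the node at `a` are listed in an order in which the least element of the
symmetric difference of two children belongs to the earlier one. -/
def RootOrdered (i : ℕ) (w : Word) (a : Fin w.length) : Prop :=
  ∀ x y, (Child i w a x ∧ Child i w a y ∧ x < y) → ∃ z, Child i w x z ∧ ¬ MemVal i w z y ∧
    ∀ u, (Child i w y u ∧ ¬ MemVal i w u x) → Before i w a z u

theorem rootOrdered_iff {i : ℕ} {a : Fin w.length} {T : BraceTree} (ha : StartsAt w a T)
    (hT : T.val ∈ finiteLevel (i + 1)) : RootOrdered i w a ↔ ∀ p q, [p, q].Sublist T.children →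
      ∃ z ∈ p.val, z ∉ q.val ∧ ∀ u ∈ q.val, u ∉ p.val → ListedBefore T z u := by
  have lT := val_mem_finiteLevel_succ.1 hT
  have lT' : ∀ s ∈ T.children, s.val ∈ finiteLevel (i + 1) :=
    fun s hs => finiteLevel_mono (by omega) (lT s hs)
  have lTT : ∀ s ∈ T.children, ∀ r ∈ s.children, r.val ∈ finiteLevel i :=
    fun s hs => val_mem_finiteLevel_succ.1 (lT' s hs)
  constructor
  · intro h p q hpq
    have hpT := hpq.subset (show p ∈ [p, q] by simp)
    have hqT := hpq.subset (show q ∈ [p, q] by simp)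
    obtain ⟨c, d, hc, hd, hlt, hp, hq⟩ := ha.exists_lt_of_sublist hT hpq
    obtain ⟨z, hz, hzn, hu⟩ := h c d ⟨hc, hd, hlt⟩
    obtain ⟨s, hs, hzs⟩ := hp.of_child (lT' p hpT) hz
    refine ⟨s.val, val_mem_val hs, ?_, ?_⟩
    · rwa [← memVal_iff hzs hq (lTT p hpT s hs) (lT' q hqT)]
    · intro u hu₁ hu₂
      obtain ⟨b, hb, rfl⟩ := mem_val.1 hu₁
      obtain ⟨u, hqu, hub⟩ := hq.exists_child (lT' q hqT) hb
      rw [← before_iff ha hT hzs hub (lTT p hpT s hs) (lTT q hqT b hb)]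
      exact hu u ⟨hqu, by rwa [memVal_iff hub hp (lTT q hqT b hb) (lT' p hpT)]⟩
  · rintro h c d ⟨hc, hd, hlt⟩
    obtain ⟨p, q, hpq, hp, hq⟩ := ha.sublist_of_lt hT hc hd hlt
    have hpT := hpq.subset (show p ∈ [p, q] by simp)
    have hqT := hpq.subset (show q ∈ [p, q] by simp)
    obtain ⟨_, hz, hzn, hu⟩ := h p q hpq
    obtain ⟨s, hs, rfl⟩ := mem_val.1 hz
    obtain ⟨z, hpz, hzs⟩ := hp.exists_child (lT' p hpT) hs
    refine ⟨z, hpz, by rwa [memVal_iff hzs hq (lTT p hpT s hs) (lT' q hqT)], ?_⟩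
    rintro u ⟨hqu, hun⟩
    obtain ⟨b, hb, hub⟩ := hq.of_child (lT' q hqT) hqu
    rw [before_iff ha hT hzs hub (lTT p hpT s hs) (lTT q hqT b hb)]
    exact hu b.val (val_mem_val hb) (by rwa [← memVal_iff hub hp (lTT q hqT b hb) (lT' p hpT)])

theorem descendant_mem_finiteLevel {i : ℕ} {s t : BraceTree} (h : t.Descendant s)
    (ht : t.val ∈ finiteLevel (i + 1)) : s.val ∈ finiteLevel (i + 1) := by
  induction h with
  | refl => exact ht
  | tail _ hc ih => exact finiteLevel_mono (by omega) (val_mem_finiteLevel_succ.1 ih _ hc)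

theorem StartsAt.of_reflTransGen {i : ℕ} {a n : Fin w.length} {t : BraceTree} (h : StartsAt w a t)
    (ht : t.val ∈ finiteLevel (i + 1)) (hn : ReflTransGen (Child i w) a n) :
    ∃ s, t.Descendant s ∧ StartsAt w n s := by
  induction hn with
  | refl => exact ⟨t, .refl, h⟩
  | tail _ hc ih =>
    obtain ⟨s, hs, hb⟩ := ih
    obtain ⟨r, hr, hrc⟩ := hb.of_child (descendant_mem_finiteLevel hs ht) hc
    exact ⟨r, hs.tail hr, hrc⟩

theorem StartsAt.exists_reflTransGen {i : ℕ} {a : Fin w.length} {s t : BraceTree}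
    (h : StartsAt w a t) (ht : t.val ∈ finiteLevel (i + 1)) (hs : t.Descendant s) :
    ∃ n, ReflTransGen (Child i w) a n ∧ StartsAt w n s := by
  induction hs with
  | refl => exact ⟨a, .refl, h⟩
  | tail hs hc ih =>
    obtain ⟨n, hn, hb⟩ := ih
    obtain ⟨c, hnc, hc⟩ := hb.exists_child (descendant_mem_finiteLevel hs ht) hc
    exact ⟨c, hn.tail hnc, hc⟩

/-- The children of every descendant of the node at `a` are listed in the order of the children of
that node. -/
def AllOrdered (i : ℕ) (w : Word) (a : Fin w.length) : Prop :=
  ∀ n, ReflTransGen (Child i w) a n →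
    ∀ x y, (Child i w n x ∧ Child i w n y ∧ x < y) → Before i w a x y

theorem allOrdered_iff {i : ℕ} {a : Fin w.length} {T : BraceTree} (ha : StartsAt w a T)
    (hT : T.val ∈ finiteLevel (i + 1)) : AllOrdered i w a ↔ ∀ n, T.Descendant n →
      n.children.Pairwise fun p q => ListedBefore T p.val q.val := by
  simp only [List.pairwise_iff_forall_sublist]
  constructor
  · intro h n hn p q hpq
    have hl := descendant_mem_finiteLevel hn hT
    have ln := val_mem_finiteLevel_succ.1 hl
    obtain ⟨b, hb, hbn⟩ := ha.exists_reflTransGen hT hn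
    obtain ⟨c, d, hc, hd, hlt, hp, hq⟩ := hbn.exists_lt_of_sublist hl hpq
    exact (before_iff ha hT hp hq (ln p (hpq.subset (by simp))) (ln q (hpq.subset (by simp)))).1
      (h b hb c d ⟨hc, hd, hlt⟩)
  · rintro h b hb c d ⟨hc, hd, hlt⟩
    obtain ⟨n, hn, hbn⟩ := ha.of_reflTransGen hT hb
    have hl := descendant_mem_finiteLevel hn hT
    have ln := val_mem_finiteLevel_succ.1 hl
    obtain ⟨p, q, hpq, hp, hq⟩ := hbn.sublist_of_lt hl hc hd hlt
    exact (before_iff ha hT hp hq (ln p (hpq.subset (by simp))) (ln q (hpq.subset (by simp)))).2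
      (h n hn hpq)

/-- The node at `u` represents an element of level `j`. -/
def Low (j : ℕ) (w : Word) (u : Fin w.length) : Prop :=
  ∃ z d : Fin w.length, (u : ℕ) = z + 1 ∧ Block j w z d

theorem low_iff {j : ℕ} {u : Fin w.length} {t : BraceTree} (hu : StartsAt w u t)
    (hpos : 0 < (u : ℕ)) : Low j w u ↔ t.val ∈ finiteLevel j := by
  constructor
  · rintro ⟨z, d, hz, s, hs, h⟩
    rwa [hu.eq (show StartsAt w u s from ⟨w.drop (d + 1), by rw [hz, h]⟩)]
  · intro ht
    obtain ⟨y, hy⟩ := hu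
    have hlen := add_length_le_of_drop_eq (by omega) hy.symm
    have := t.length_enc_pos
    have hd := drop_add_of_drop_eq hy.symm
    refine ⟨⟨u - 1, by omega⟩, ⟨u + t.enc.length - 1, by omega⟩, by simp; omega, t, ht, ?_⟩
    simp only
    rw [show (u : ℕ) - 1 + 1 = u by omega, show (u : ℕ) + t.enc.length - 1 + 1 = u + t.enc.length by
      omega, hd, hy]

/-- Every set of children of the node at `a` that represent elements of level `j` is represented by a
child of that node. -/
def Full (i j : ℕ) (w : Word) (a : Fin w.length) : Prop :=
  ∀ A : Set (Fin w.length), (∀ u, u ∈ A → Child i w a u ∧ Low j w u) →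
    ∃ z, Child i w a z ∧ (∀ u, u ∈ A → MemVal i w u z) ∧
      ∀ v, Child i w z v → ∃ u, u ∈ A ∧ SameVal i i w v u

/-- Closure under forming sets of low-level children builds up the levels one after another inside
`T.val`; conversely `V_(j+1)` contains every set of elements of `V_j`. -/
theorem full_iff {j : ℕ} {a : Fin w.length} {T : BraceTree} (ha : StartsAt w a T)
    (hT : T.val ∈ finiteLevel (j + 1 + 1)) :
    Full (j + 1) j w a ↔ T.val = finiteLevel (j + 1) := by
  have lT := val_mem_finiteLevel_succ.1 hT
  have lT' : ∀ s ∈ T.children, s.val ∈ finiteLevel (j + 1 + 1) :=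
    fun s hs => finiteLevel_mono (by omega) (lT s hs)
  have lTT : ∀ s ∈ T.children, ∀ r ∈ s.children, r.val ∈ finiteLevel (j + 1) :=
    fun s hs => val_mem_finiteLevel_succ.1 (lT' s hs)
  have hpos : ∀ u, Child (j + 1) w a u → 0 < (u : ℕ) := by
    rintro u ⟨-, e, -, he⟩
    omega
  constructor
  · intro h
    have key : ∀ k ≤ j + 1, ∀ x ∈ finiteLevel k, x ∈ T.val := by
      intro k
      induction k with
      | zero => intro _ x hx; rw [finiteLevel_zero] at hx; exact absurd hx (ZFSet.notMem_empty _)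
      | succ k ih =>
        intro hk x hx
        have hsub := mem_finiteLevel_succ.1 hx
        -- The set consists of all children of the root that represent elements of `x`; by the
        -- induction hypothesis every element of `x` occurs there.
        obtain ⟨z, hz, h₁, h₂⟩ := h {u | Child (j + 1) w a u ∧
          ∃ s ∈ T.children, StartsAt w u s ∧ s.val ∈ x} (by
            rintro u ⟨hu, s, hs, hus, hx⟩
            exact ⟨hu, (low_iff hus (hpos u hu)).2 (finiteLevel_mono (by omega) (hsub _ hx))⟩)
        obtain ⟨t, ht, hzt⟩ := ha.of_child hT hz
        rw [mem_val]
        refine ⟨t, ht, ZFSet.ext fun y => ⟨fun hy => ?_, fun hy => ?_⟩⟩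
        · obtain ⟨r, hr, rfl⟩ := mem_val.1 hy
          obtain ⟨v, hv, hvr⟩ := hzt.exists_child (lT' t ht) hr
          obtain ⟨u, ⟨-, s, hs, hus, hx⟩, huv⟩ := h₂ v hv
          rwa [(sameVal_iff (by omega) hvr hus (lTT t ht r hr) (lT s hs)).1 huv]
        · obtain ⟨s, hs, rfl⟩ := mem_val.1 (ih (by omega) y (hsub y hy))
          obtain ⟨u, hu, hus⟩ := ha.exists_child hT hs
          exact (memVal_iff hus hzt (lT s hs) (lT' t ht)).1 (h₁ u ⟨hu, s, hs, hus, hy⟩)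
    exact ZFSet.ext fun y => ⟨fun hy => mem_finiteLevel_of_mem hT hy, key _ le_rfl y⟩
  · intro hV A hA
    let x := T.val.sep fun y => ∃ u ∈ A, ∃ s, StartsAt w u s ∧ s.val = y
    have hx : x ∈ T.val := by
      rw [hV, mem_finiteLevel_succ]
      intro y hy
      obtain ⟨-, u, hu, s, hus, rfl⟩ := ZFSet.mem_sep.1 hy
      obtain ⟨hu, hl⟩ := hA u hu
      exact (low_iff hus (hpos u hu)).1 hl
    obtain ⟨t, ht, hxt⟩ := mem_val.1 hx
    obtain ⟨z, hz, hzt⟩ := ha.exists_child hT ht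
    refine ⟨z, hz, ?_, ?_⟩
    · intro u hu
      obtain ⟨s, hs, hus⟩ := ha.of_child hT (hA u hu).1
      rw [memVal_iff hus hzt (lT s hs) (lT' t ht), hxt]
      exact ZFSet.mem_sep.2 ⟨val_mem_val hs, u, hu, s, hus, rfl⟩
    · intro v hv
      obtain ⟨r, hr, hvr⟩ := hzt.of_child (lT' t ht) hv
      have := val_mem_val hr
      rw [hxt] at this
      obtain ⟨-, u, hu, s, hus, e⟩ := ZFSet.mem_sep.1 this
      obtain ⟨s', hs', hus'⟩ := ha.of_child hT (hA u hu).1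
      rw [hus.eq hus'] at e
      exact ⟨u, hu, (sameVal_iff (by omega) hvr hus' (lTT t ht r hr) (lT s' hs')).2 e.symm⟩

/-- The position `a` is the first one, and `w` is the word of a tree that represents a subset of
level `i`. -/
def IsRoot (i : ℕ) (w : Word) (a : Fin w.length) : Prop :=
  (a : ℕ) = 0 ∧ w.get a = Letter.l ∧ ∃ e d : Fin w.length, ReflTransGen (Block i w) a e ∧
    (d : ℕ) = e + 1 ∧ w.get d = Letter.r ∧ (d : ℕ) + 1 = w.length

theorem isRoot_iff {i : ℕ} {a : Fin w.length} : IsRoot i w a ↔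
    (a : ℕ) = 0 ∧ ∃ T : BraceTree, w = T.enc ∧ T.val ∈ finiteLevel (i + 1) := by
  constructor
  · rintro ⟨h₀, hl, e, d, h, hd, hr, hlast⟩
    obtain ⟨ts, hts, h⟩ := reflTransGen_block.1 h
    refine ⟨h₀, node ts, ?_, val_mem_finiteLevel_succ.2 (by simpa using hts)⟩
    have : w = w.drop a := by simp [h₀]
    rw [this, drop_eq_get_cons a, h, hl, ← hd, drop_eq_get_cons d, hr, hlast, enc_node]
    simp
  · rintro ⟨h₀, T, rfl, hT⟩
    have hlen : T.enc.length = (T.children.flatMap enc).length + 2 := by rw [enc_eq]; simp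
    have hdrop := drop_eq_get_cons a
    rw [h₀, List.drop_zero] at hdrop
    have hE := hdrop.symm.trans T.enc_eq
    rw [List.cons.injEq, zero_add] at hE
    let e : Fin T.enc.length := ⟨(T.children.flatMap enc).length, by omega⟩
    let d : Fin T.enc.length := ⟨(T.children.flatMap enc).length + 1, by omega⟩
    have hd := drop_add_of_drop_eq hE.2
    rw [show 1 + (T.children.flatMap enc).length = (d : ℕ) from Nat.add_comm _ _, drop_eq_get_cons d,
      List.cons.injEq] at hd
    refine ⟨h₀, hE.1, e, d, reflTransGen_block.2 ⟨T.children, val_mem_finiteLevel_succ.1 hT, ?_⟩,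
      rfl, hd.1, hlen.symm⟩
    rw [h₀, zero_add, hE.2, show (e : ℕ) + 1 = d from rfl, drop_eq_get_cons d, hd.1, hd.2]

/-- The word `w` represents level `i` of the von Neumann hierarchy and is hereditarily sorted. -/
def IsSortedLevel (i : ℕ) (w : Word) : Prop :=
  ∃ a, IsRoot i w a ∧ (i ≠ 0 → Full i (i - 1) w a) ∧ RootOrdered i w a ∧ AllOrdered i w a

/-- `RootOrdered` is the clause of `MinDiffLt` with the comparison of elements replaced by
precedence in the list of the root. Once the value is the transitive set `V_i`, this list contains
all those elements, so precedence there and `MinDiffLt` agree. -/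
theorem isSortedLevel_iff {i : ℕ} : IsSortedLevel i w ↔
    ∃ T : BraceTree, w = T.enc ∧ T.val = finiteLevel i ∧ T.HereditarilySorted := by
  have level : ∀ (a : Fin w.length) (T : BraceTree), StartsAt w a T →
      T.val ∈ finiteLevel (i + 1) → ((i ≠ 0 → Full i (i - 1) w a) ↔ T.val = finiteLevel i) := by
    intro a T ha hT
    cases i with
    -- For `i = 0` the bound `hT` already forces the empty set; `Full` would fail, since `A = ∅`
    -- demands a child.
    | zero =>
      simp only [ne_eq, not_true_eq_false, false_imp_iff, true_iff]
      rw [finiteLevel_zero, ZFSet.eq_empty]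
      intro y hy
      have := mem_finiteLevel_of_mem hT hy
      rw [finiteLevel_zero] at this
      exact ZFSet.notMem_empty _ this
    | succ j => simpa using full_iff ha hT
  have transitive : ∀ {T p : BraceTree} {x : ZFSet}, T.val = finiteLevel i →
      p ∈ T.children → x ∈ p.val → x ∈ T.val := by
    intro T p x hT hp hx
    have := val_mem_val hp
    rw [hT] at this ⊢
    exact mem_finiteLevel_of_mem (finiteLevel_mono (Nat.le_succ i) this) hx
  constructor
  · rintro ⟨a, hroot, hfull, hroot', hall⟩
    obtain ⟨h₀, T, hw, hT⟩ := isRoot_iff.1 hroot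
    have ha : StartsAt w a T := by simp [StartsAt, h₀, hw]
    rw [level a T ha hT] at hfull
    rw [rootOrdered_iff ha hT] at hroot'
    rw [allOrdered_iff ha hT] at hall
    refine ⟨T, hw, hfull, fun n hn => (hall n hn).imp fun {p q} h => ?_⟩
    -- Induction on membership: the witness `z` is an element of `x`, so its precedence over each
    -- `u` already yields `MinDiffLt z u`.
    have key : ∀ x y : ZFSet, ListedBefore T x y → MinDiffLt x y := by
      intro x
      induction x using ZFSet.inductionOn with
      | h x ih =>
      rintro y ⟨p, q, hpq, rfl, rfl⟩
      obtain ⟨z, hz, hzn, h⟩ := hroot' p q hpq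
      exact .mk hz hzn fun u hu hun => ih z hz u (h u hu hun)
    exact key _ _ h
  · rintro ⟨T, hw, hV, hs⟩
    have hT : T.val ∈ finiteLevel (i + 1) := by
      rw [mem_finiteLevel_succ, hV]
      exact fun _ h => h
    have lT := val_mem_finiteLevel_succ.1 hT
    let a : Fin w.length := ⟨0, by rw [hw]; exact T.length_enc_pos⟩
    have ha : StartsAt w a T := by simp [StartsAt, a, hw]
    -- Both sets are children of the root; the opposite order contradicts asymmetry and coincidence
    -- contradicts irreflexivity.
    have key : ∀ x ∈ T.val, ∀ y ∈ T.val, MinDiffLt x y → ListedBefore T x y := by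
      intro x hx y hy hxy
      obtain ⟨p, hp, rfl⟩ := mem_val.1 hx
      obtain ⟨q, hq, rfl⟩ := mem_val.1 hy
      have hsT : ∀ {a b}, [a, b].Sublist T.children → MinDiffLt a.val b.val :=
        (hs T .refl).forall_sublist
      obtain ⟨r₁, r₂, e⟩ := List.append_of_mem hp
      rw [e, List.mem_append, List.mem_cons] at hq
      rcases hq with hq | rfl | hq
      · refine absurd hxy (hsT (a := q) (b := p) ?_).asymm
        rw [e, List.cons_sublist_iff]
        exact ⟨r₁, p :: r₂, rfl, hq, by simp⟩
      · exact absurd hxy (MinDiffLt.irrefl _)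
      · refine ⟨p, q, ?_, rfl, rfl⟩
        rw [e, List.cons_sublist_iff]
        exact ⟨r₁ ++ [p], r₂, by simp, by simp, by simpa using hq⟩
    refine ⟨a, isRoot_iff.2 ⟨rfl, T, hw, hT⟩, (level a T ha hT).2 hV,
      (rootOrdered_iff ha hT).2 ?_, (allOrdered_iff ha hT).2 ?_⟩
    · intro p q hpq
      obtain ⟨hz, hzn, h⟩ := List.pairwise_iff_forall_sublist.1 (hs T .refl) hpq
      exact ⟨_, hz, hzn, fun u hu hun => key _ (transitive hV (hpq.subset (by simp)) hz) _
        (transitive hV (hpq.subset (by simp)) hu) (h u hu hun)⟩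
    · intro n hn
      have hnl := val_mem_finiteLevel_succ.1 (descendant_mem_finiteLevel hn hT)
      refine (hs n hn).imp_of_mem fun {p q} hp hq hpq => key _ ?_ _ ?_ hpq
      · rw [hV]; exact hnl p hp
      · rw [hV]; exact hnl q hq

end MSO

/-! ### Sizes of the defining formulas -/

namespace MSO

/-- One level adds 35: 13 for the closure, 14 for two successors, 2 letters, 2 quantifiers and 4
conjunctions. -/
theorem isDefinable₂_block (j : ℕ) : IsDefinable₂ (35 * j + 2) (Block j) := by
  induction j with
  | zero =>
    refine IsDefinable.of_iff (m := 0) (k := 2) (.not (.eq 0 0)) le_rfl fun w P p => ?_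
    simp [block_zero]
  | succ j ih =>
    refine IsDefinable.of_iff (m := 0) (k := 2)
      (.ex (.ex (.and (isDefinable₂_succ.app 2 1) (.and (.letter .l 1)
        (.and (ih.reflTransGen.app 1 0) (.and (isDefinable₂_succ.app 0 3) (.letter .r 3)))))))
      (by omega) fun w P p => ?_
    exact block_succ.symm

theorem isDefinable₂_child (i : ℕ) : IsDefinable₂ (35 * i + 26) (Child i) := by
  refine IsDefinable.of_iff (m := 0) (k := 2)
    (.and (.letter .l 1) (.ex (.and ((isDefinable₂_block i).reflTransGen.app 1 0)
      (isDefinable₂_succ.app 0 2)))) (by omega) fun w P p => Iff.rfl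

theorem isDefinable₂_sameVal (i j : ℕ) :
    IsDefinable₂ (1 + j * (6 * (35 * i + 26) + 10)) (SameVal i j) := by
  induction j with
  | zero =>
    refine IsDefinable.of_iff (m := 0) (k := 2) (.eq 0 0) (by omega) fun w P p => ?_
    simp [SameVal]
  | succ j ih =>
    have hc := isDefinable₂_child i
    refine IsDefinable.of_iff (m := 0) (k := 2)
      (.all (.imp (.or (hc.app 1 0) (hc.app 2 0)) (.ex (.and
        (.or (.and (hc.app 2 1) (hc.app 3 0)) (.and (hc.app 3 1) (hc.app 2 0))) (ih.app 1 0)))))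
      (by rw [Nat.add_one_mul j]; omega) fun w P p => Iff.rfl

section

variable {i c e : ℕ}

theorem isDefinable₂_memVal (hc : IsDefinable₂ c (Child i)) (he : IsDefinable₂ e (SameVal i i)) :
    IsDefinable₂ (c + e + 2) (MemVal i) :=
  IsDefinable.of_iff (m := 0) (k := 2) (.ex (.and (hc.app 2 0) (he.app 1 0))) (by omega)
    fun _ _ _ => Iff.rfl

theorem isDefinable₃_before (hc : IsDefinable₂ c (Child i)) (he : IsDefinable₂ e (SameVal i i)) :
    IsDefinable₃ (2 * c + 2 * e + 7) (Before i) :=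
  IsDefinable.of_iff (m := 0) (k := 3)
    (.ex (.ex (.and (.and (hc.app 2 1) (.and (hc.app 2 0) (.lt 1 0)))
      (.and (he.app 1 3) (he.app 0 4))))) (by omega) fun _ _ _ => Iff.rfl

theorem isDefinable₁_rootOrdered (hc : IsDefinable₂ c (Child i))
    (he : IsDefinable₂ e (SameVal i i)) :
    IsDefinable₁ (8 * c + 4 * e + 30) (RootOrdered i) := by
  have hm := isDefinable₂_memVal hc he
  exact IsDefinable.of_iff (m := 0) (k := 1)
    (.all (.all (.imp (.and (hc.app 2 1) (.and (hc.app 2 0) (.lt 1 0)))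
      (.ex (.and (hc.app 2 0) (.and (.not (hm.app 0 1)) (.all
        (.imp (.and (hc.app 2 0) (.not (hm.app 0 3)))
          ((isDefinable₃_before hc he).app 4 1 0)))))))))
    (by omega) fun _ _ _ => Iff.rfl

theorem isDefinable₁_allOrdered (hc : IsDefinable₂ c (Child i))
    (he : IsDefinable₂ e (SameVal i i)) :
    IsDefinable₁ (5 * c + 2 * e + 30) (AllOrdered i) :=
  IsDefinable.of_iff (m := 0) (k := 1)
    (.all (.imp (hc.reflTransGen.app 1 0) (.all (.all
      (.imp (.and (hc.app 2 1) (.and (hc.app 2 0) (.lt 1 0)))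
        ((isDefinable₃_before hc he).app 3 1 0))))))
    (by omega) fun _ _ _ => Iff.rfl

theorem isDefinable₁_low (j : ℕ) : IsDefinable₁ (35 * j + 12) (Low j) :=
  IsDefinable.of_iff (m := 0) (k := 1)
    (.ex (.ex (.and (isDefinable₂_succ.app 1 2) ((isDefinable₂_block j).app 1 0))))
    (by omega) fun _ _ _ => Iff.rfl

theorem isDefinable₁_full (hc : IsDefinable₂ c (Child i)) (he : IsDefinable₂ e (SameVal i i))
    (j : ℕ) : IsDefinable₁ (4 * c + 2 * e + 35 * j + 40) (Full i j) := by
  have hm := isDefinable₂_memVal hc he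
  exact IsDefinable.of_iff (m := 0) (k := 1)
    (.allSet (.imp (.all (.imp (.mem 0 0) (.and (hc.app 1 0) ((isDefinable₁_low j).app 0))))
      (.ex (.and (hc.app 1 0) (.and (.all (.imp (.mem 0 0) (hm.app 0 1)))
        (.all (.imp (hc.app 1 0) (.ex (.and (.mem 0 0) (he.app 1 0))))))))))
    (by omega) fun _ _ _ => Iff.rfl

theorem isDefinable₁_isRoot (i : ℕ) : IsDefinable₁ (35 * i + 40) (IsRoot i) :=
  IsDefinable.of_iff (m := 0) (k := 1)
    (.and (isDefinable₁_first.app 0) (.and (.letter .l 0) (.ex (.ex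
      (.and ((isDefinable₂_block i).reflTransGen.app 2 1) (.and (isDefinable₂_succ.app 1 0)
        (.and (.letter .r 0) (isDefinable₁_last.app 0))))))))
    (by omega) fun _ _ _ => Iff.rfl

/-- The condition `q` does not depend on the word, so it is decided when the formula is chosen; if
it fails, `∀ x, x = x` is used. -/
theorem IsDefinable.imp_of_prop {m k s : ℕ}
    {R : ∀ w : Word, (Fin m → Set (Fin w.length)) → (Fin k → Fin w.length) → Prop}
    (h : IsDefinable s R) (q : Prop) :
    IsDefinable (s + 2) (fun w P p => q → R w P p) := by
  by_cases hq : q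
  · exact h.of_iff (by omega) fun _ _ _ => by simp [hq]
  · exact (IsDefinable.all (.eq 0 0)).of_iff (by omega) fun _ _ _ => by simp [hq]

end

/-- A sentence of quadratic size that defines the sorted encoding of level `i`. -/
theorem exists_sentence (i : ℕ) : ∃ φ : Sentence, φ.size ≤ 5000 * (i + 1) ^ 2 ∧
    ∀ w : Word, Models w φ ↔ IsSortedLevel i w := by
  have hc := isDefinable₂_child i
  have he := isDefinable₂_sameVal i i
  have key : IsDefinable (m := 0) (k := 0) (5000 * (i + 1) ^ 2) fun w _ _ => IsSortedLevel i w := by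
    refine IsDefinable.of_iff
      (.ex (.and ((isDefinable₁_isRoot i).app 0) (.and
        (((isDefinable₁_full hc he (i - 1)).app 0).imp_of_prop (i ≠ 0))
        (.and ((isDefinable₁_rootOrdered hc he).app 0)
          ((isDefinable₁_allOrdered hc he).app 0))))) ?_ fun _ _ _ => Iff.rfl
    have : i - 1 ≤ i := by omega
    nlinarith
  obtain ⟨φ, hs, hφ⟩ := key
  exact ⟨φ, hs, fun w => hφ w _ _⟩

end MSO

/-! ### Cardinalities of the levels and the tower lower bound -/

theorem finiteLevel_finite_and_ncard (i : ℕ) :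
    (finiteLevel i : Set ZFSet.{0}).Finite ∧
      (finiteLevel (i + 1) : Set ZFSet.{0}).ncard = tower i := by
  have step : ∀ i, (finiteLevel i : Set ZFSet.{0}).Finite →
      (finiteLevel (i + 1) : Set ZFSet.{0}).Finite ∧
        (finiteLevel (i + 1) : Set ZFSet.{0}).ncard = 2 ^ (finiteLevel i : Set ZFSet.{0}).ncard := by
    intro i hfin
    have e : (finiteLevel (i + 1) : Set ZFSet.{0}) ≃ 𝒫 (finiteLevel i : Set ZFSet.{0}) := by
      rw [finiteLevel, Nat.cast_add, Nat.cast_one, ZFSet.vonNeumann_add_one]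
      exact ZFSet.powersetEquiv _
    refine ⟨?_, ?_⟩
    · have : Finite (𝒫 (finiteLevel i : Set ZFSet.{0})) := hfin.finite_subsets.to_subtype
      exact Set.finite_coe_iff.1 (Finite.of_equiv _ e.symm)
    · rw [← Set.ncard_powerset _ hfin]
      exact Nat.card_congr e
  induction i with
  | zero =>
    have h₀ : (finiteLevel 0 : Set ZFSet.{0}) = ∅ := by
      rw [finiteLevel_zero]; exact ZFSet.coe_empty
    refine ⟨h₀ ▸ Set.finite_empty, ?_⟩
    rw [(step 0 (h₀ ▸ Set.finite_empty)).2, h₀]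
    simp [tower]
  | succ i ih =>
    have h := (step i ih.1).1
    refine ⟨h, ?_⟩
    rw [(step _ h).2, ih.2]
    rfl

theorem exists_tree_of_mem_finiteLevel (i : ℕ) : ∀ x ∈ finiteLevel i, ∃ t : BraceTree, t.val = x := by
  induction i with
  | zero => intro x hx; rw [finiteLevel_zero] at hx; exact absurd hx (ZFSet.notMem_empty _)
  | succ i ih =>
    intro x hx
    have hsub := mem_finiteLevel_succ.1 hx
    have : Nonempty BraceTree := ⟨.nil⟩
    choose! f hf using ih
    have hfin : (x : Set ZFSet.{0}).Finite := (finiteLevel_finite_and_ncard i).1.subset hsub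
    refine ⟨.node (hfin.toFinset.toList.map f), ZFSet.ext fun y => ?_⟩
    rw [BraceTree.mem_val, BraceTree.children_node]
    simp only [List.mem_map, Finset.mem_toList, Set.Finite.mem_toFinset, SetLike.mem_coe]
    constructor
    · rintro ⟨_, ⟨z, hz, rfl⟩, rfl⟩
      rwa [hf z (hsub z hz)]
    · exact fun hy => ⟨f y, ⟨y, hy, rfl⟩, hf y (hsub y hy)⟩

theorem BraceTree.ncard_val_le (t : BraceTree) : (t.val : Set ZFSet.{0}).ncard ≤ t.enc.length := by
  classical
  have : (t.val : Set ZFSet.{0}) = ((t.children.map val).toFinset : Finset ZFSet.{0}) := by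
    ext x
    simp [mem_val]
  rw [this, Set.ncard_coe_finset]
  refine (List.toFinset_card_le _).trans ?_
  rw [List.length_map]
  exact t.length_children_le

theorem tower_mono : Monotone tower :=
  monotone_nat_of_le_succ fun _ => Nat.lt_two_pow_self.le

namespace MSO

theorem Defines.modelLengths_eq {φ : Sentence} {w : Word} (h : Defines φ w) :
    modelLengths φ = {w.length} := by
  ext k
  constructor
  · rintro ⟨v, hv, hm, rfl⟩
    by_contra hne
    exact h.2.2 v hv (fun e => hne (by rw [e]; rfl)) hm
  · rintro rfl
    exact ⟨w, h.1, h.2.1, rfl⟩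

theorem Defines.minLength_eq {φ : Sentence} {w : Word} (h : Defines φ w) :
    minLength φ = w.length := by
  rw [minLength, h.modelLengths_eq, csInf_singleton]

theorem Defines.maxLength_eq {φ : Sentence} {w : Word} (h : Defines φ w) :
    maxLength φ = w.length := by
  rw [maxLength, h.modelLengths_eq, csSup_singleton]

theorem finite_sizeFragment (n : ℕ) : (sizeFragment n).Finite := Formula.finite_setOf_size_le n 0 0

variable {n : ℕ} {φ : Sentence} {w : Word}

theorem length_le_LS (hφ : φ ∈ sizeFragment n) (h : Defines φ w) : w.length ≤ LS (sizeFragment n) :=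
  le_csSup ((finite_sizeFragment n).image minLength).bddAbove ⟨φ, hφ, h.minLength_eq⟩

theorem length_le_H (hφ : φ ∈ sizeFragment n) (h : Defines φ w) : w.length ≤ H (sizeFragment n) :=
  le_csSup ((finite_sizeFragment n).image maxLength).bddAbove ⟨φ, hφ, h.maxLength_eq⟩

theorem length_le_DN (hφ : φ ∈ sizeFragment n) (h : Defines φ w) : w.length ≤ DN (sizeFragment n) := by
  refine le_csSup (((finite_sizeFragment n).image minLength).subset ?_).bddAbove
    ⟨w, ⟨φ, hφ, h⟩, rfl⟩
  rintro _ ⟨v, ⟨ψ, hψ, hv⟩, rfl⟩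
  exact ⟨ψ, hψ, hv.minLength_eq⟩

end MSO

theorem exists_defining_sentence (i : ℕ) : ∃ (φ : MSO.Sentence) (w : Word),
    φ.size ≤ 5000 * (i + 1) ^ 2 ∧ IsLeastEncoding w (finiteLevel i) ∧ MSO.Defines φ w ∧
      tower (i - 1) ≤ w.length := by
  obtain ⟨φ, hs, hφ⟩ := MSO.exists_sentence i
  -- Level `i` is itself an element of level `i + 1`.
  obtain ⟨t, ht⟩ := exists_tree_of_mem_finiteLevel (i + 1) (finiteLevel i)
    (mem_finiteLevel_succ.2 fun _ h => h)
  obtain ⟨T, hT, hmin⟩ := t.exists_isMinimal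
  rw [ht] at hT
  refine ⟨φ, T.enc, hs, hT ▸ hmin.isLeastEncoding, ⟨by simp [BraceTree.enc], ?_, ?_⟩, ?_⟩
  · exact (hφ _).2 (MSO.isSortedLevel_iff.2 ⟨T, rfl, hT, hmin.hereditarilySorted⟩)
  · intro v _ hne hv
    obtain ⟨S, rfl, hS, hsort⟩ := MSO.isSortedLevel_iff.1 ((hφ v).1 hv)
    exact hne (by rw [hsort.eq hmin.hereditarilySorted (hS.trans hT.symm)])
  · cases i with
    | zero => exact T.length_enc_pos
    | succ i =>
      have := T.ncard_val_le
      rwa [hT, (finiteLevel_finite_and_ncard i).2] at this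

theorem theorem4 :
    ∃ (c : ℕ) (ψ : ℕ → MSO.Sentence) (w : ℕ → Word), 0 < c ∧
      (fun i : ℕ => ((ψ i).size : ℝ)) =O[atTop] (fun i : ℕ => (i : ℝ) ^ 2) ∧
      (∀ i : ℕ, IsLeastEncoding (w i) (ZFSet.vonNeumann (i : Ordinal.{0})) ∧
        MSO.Defines (ψ i) (w i)) ∧
      {n : ℕ |
        (∃ i : ℕ, ψ i ∈ MSO.sizeFragment n ∧ twr (√((n : ℝ) / (c : ℝ))) ≤ (w i).length) ∧
        twr (√((n : ℝ) / (c : ℝ))) ≤ MSO.DN (MSO.sizeFragment n) ∧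
        twr (√((n : ℝ) / (c : ℝ))) ≤ MSO.LS (MSO.sizeFragment n) ∧
        twr (√((n : ℝ) / (c : ℝ))) ≤ MSO.H (MSO.sizeFragment n)}.Infinite := by
  choose ψ w hsize hleast hdef hlen using exists_defining_sentence
  -- The constant is `9 * 5000`: for `n = 5000 * (k + 3) ^ 2` the root of `n / c` is `(k + 3) / 3`,
  -- which is at most `k + 1`, and the word for level `k + 2` has length at least `tower (k + 1)`.
  refine ⟨45000, ψ, w, by norm_num, ?_, fun i => ⟨hleast i, hdef i⟩, ?_⟩
  -- For `i ≥ 1` one has `i + 1 ≤ 2 * i`, whence `20000 = 4 * 5000`.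
  · refine IsBigO.of_bound 20000 ?_
    filter_upwards [eventually_ge_atTop 1] with i hi
    have h₁ : ((ψ i).size : ℝ) ≤ 5000 * ((i : ℝ) + 1) ^ 2 := by exact_mod_cast hsize i
    have h₂ : (1 : ℝ) ≤ i := by exact_mod_cast hi
    rw [Real.norm_of_nonneg (by positivity), Real.norm_of_nonneg (by positivity)]
    nlinarith
  · refine Set.infinite_of_injective_forall_mem
      (f := fun k : ℕ => 5000 * (k + 2 + 1) ^ 2) ?_ fun k => ?_
    · intro a b hab
      have := Nat.pow_left_injective (n := 2) (by norm_num)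
        (Nat.eq_of_mul_eq_mul_left (by norm_num) hab)
      simpa using this
    · have hmem : ψ (k + 2) ∈ MSO.sizeFragment (5000 * (k + 2 + 1) ^ 2) := hsize (k + 2)
      have hle : twr (√(((5000 * (k + 2 + 1) ^ 2 : ℕ) : ℝ) / ((45000 : ℕ) : ℝ))) ≤
          (w (k + 2)).length := by
        refine (tower_mono (Nat.ceil_le.2 ?_)).trans (hlen (k + 2))
        rw [show k + 2 - 1 = k + 1 by omega]
        refine Real.sqrt_le_iff.2 ⟨by positivity, ?_⟩
        push_cast
        rw [div_le_iff₀ (by norm_num)]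
        have : (0 : ℝ) ≤ k := by positivity
        nlinarith
      have hd := hdef (k + 2)
      exact ⟨⟨k + 2, hmem, hle⟩, hle.trans (MSO.length_le_DN hmem hd),
        hle.trans (MSO.length_le_LS hmem hd), hle.trans (MSO.length_le_H hmem hd)⟩
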